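/- **Setting.** There are two users $i\in\{1,2\}$; $i'=3-i$ is the other user. Fix positive integers $k_i,N_i$, probabilities $0<q_i\le 1$, reals $\theta_i,\nu_i,\gamma_i>0$ and $a_i\ge 0$. Put $\eta_i=k_i/N_i$, $\lambda_i=k_iq_i$, $\mu_i=\eta_i/\lambda_i=1/(N_iq_i)$, $\mathsf C(x)=\frac12\log_2(1+x)$, $\phi_i=\mathsf C(\gamma_i)$ and $\psi_i=\mathsf C\big(\gamma_i/(1+a_{i'}\gamma_{i'})\big)$. For a scaling parameter $n\in\mathbb N$ let $n_i=\lfloor n\theta_i\rfloor$ and let $n'=o(n)$ be the preamble length. From time slot $\lfloor n\nu_i\rfloor$ on, at the end of each slot a packet of $k_i$ bits enters the buffer of Tx $i$ with probability $q_i$ (independently over slots and users), until $k_in$ bits have been generated. For $1\le j\le N_i$ let $\tau_i^{(j)}$ be the first slot, not earlier than $\lfloor n\nu_i\rfloor$ (if $j=1$) or than $\tau_i^{(j-1)}+n'+n_i$ (if $j>1$), at whose end the buffer holds at least $\lfloor n\eta_i\rfloor$ bits. These bits are removed from the buffer and represented by one of the $2^{\lfloor n\eta_i\rfloor}$ codewords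 of length $n_i$, and the $j$-th burst of Tx $i$, i.e. its preamble sequence of length $n'$ (the same in all its bursts) followed by the codeword, is sent in slots $\tau_i^{(j)}+1,\dots,\tau_i^{(j)}+n'+n_i$. Outside its bursts Tx $i$ sends $x_{i,t}=0$. Codebook and preamble symbols of Tx $i$ are independent $\mathrm N(0,\gamma_i)$. Rx $i$ receives $y_{i,t}=x_{i,t}+\sqrt{a_{i'}}\,x_{i',t}+z_{i,t}$ with white noise $z_{i,t}\sim \mathrm N(0,1)$. Arrivals, codebooks, preambles and noise are independent. Assume $\mu_i>\theta_i$ for each $i$ with $N_i>1$, and $j_2\mu_2-j_1\mu_1+\nu_2-\nu_1\notin\{0,\theta_1,-\theta_2,\theta_1-\theta_2\}$ for all $1\le j_1\le N_1$, $1\le j_2\le N_2$. For the $j$-th codeword of Tx $i$ ($1\le j\le N_i$) put $d_{j'}=j'\mu_{i'}-j\mu_i+\nu_{i'}-\nu_i$, $1\le j'\le N_{i'}$ (the offset, on the time axis scaled by $1/n$, of the $j'$-th burst of Tx $i'$ from this codeword). Let $\omega^-_{i,j}$ be the index $j'$ of the burst covering the left end of the codeword, $-\theta_{i'}<d_{j'}<0$;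 let $\omega^+_{i,j}$ be the index $j'$ of the burst covering its right end, $\theta_i-\theta_{i'}<d_{j'}<\theta_i$; each is at most one index, and is set to $0$ if there is none. Let $\omega_{i,j}$ be the number of $j'$ with $0<d_{j'}<\theta_i-\theta_{i'}$ (bursts contained in the codeword). **Decoder.** Rx $i$ knows all $\tau_1^{(\cdot)},\tau_2^{(\cdot)}$ and the codebook of Tx $i$, and treats interference as noise. It splits the slots $\tau_i^{(j)}+n'+1,\dots,\tau_i^{(j)}+n'+n_i$ of the $j$-th codeword into the segments that overlap with the individual bursts of Tx $i'$ and the interference-free segments before, between and after these bursts, and it looks for the unique message whose codeword is, on every nonempty segment, $\epsilon$-jointly typical with the received signal: with respect to the density $\mathrm g(x;\gamma_i)\,\mathrm g(y-x;1+a_{i'}\gamma_{i'})$ on a segment with interference and $\mathrm g(x;\gamma_i)\,\mathrm g(y-x;1)$ on a segment without, where $\mathrm g(\cdot;\sigma^2)$ is the centred Gaussian density of variance $\sigma^2$. (A pair $(\vec x,\vec y)\in\mathbb R^m\times\mathbb R^m$ is $\epsilon$-jointly typical for a density $p$ with marginals $p_1,p_2$ if $\big|\frac1m\sum_l\log_2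 p_1(x_l)+h(p_1)\big|$, $\big|\frac1m\sum_l\log_2 p_2(y_l)+h(p_2)\big|$ and $\big|\frac1m\sum_l\log_2 p(x_l,y_l)+h(p)\big|$ are all $<\epsilon$, with $h$ the differential entropy in bits.) The $j$-th message of Tx $i$ is *reliably decoded* if, for all sufficiently small $\epsilon>0$, the probability (over arrivals, codebooks, preambles and noise) that the transmitted message is not the unique message passing the test tends to $0$ as $n\to\infty$, whatever the transmitted messages are. **Proposition.** Suppose $\omega^-_{i,j}\ne0$ and $\omega^+_{i,j}\neq 0$. (1) If $\omega^-_{i,j}\ne\omega^+_{i,j}$ and $$\eta_i-\frac1{\lambda_{i'}}(1+\omega_{i,j})(\phi_i-\psi_i)\,\eta_{i'}<\theta_i\psi_i-\theta_{i'}(1+\omega_{i,j})(\phi_i-\psi_i),$$ then the $j$-th message of Tx $i$ is reliably decoded. (2) If $\omega^-_{i,j}=\omega^+_{i,j}$ and $\eta_i<\theta_i\psi_i$, then the $j$-th message of Tx $i$ is reliably decoded. -/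

import Mathlib

open MeasureTheory ProbabilityTheory Filter Topology
open scoped NNReal ENNReal

noncomputable section

namespace GICSDA

/-! ### Typicality with respect to a density on the plane -/

/-- Differential entropy, in bits, of a density `f`. -/
def diffEntropy {α : Type*} [MeasureSpace α] (f : α → ℝ) : ℝ :=
  -∫ x, f x * Real.logb 2 (f x)

/-- First marginal of a density on the plane. -/
def fstMarginal (p : ℝ × ℝ → ℝ) (x : ℝ) : ℝ := ∫ y, p (x, y)

/-- Second marginal of a density on the plane. -/
def sndMarginal (p : ℝ × ℝ → ℝ) (y : ℝ) : ℝ := ∫ x, p (x, y)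

/-- The two sequences `x`, `y`, restricted to the finite (nonempty) set `T` of time slots, form an
`ε`-jointly typical pair with respect to the density `p`; the block length is the size of `T`. -/
def JointlyTypical (ε : ℝ) (p : ℝ × ℝ → ℝ) (T : Finset ℕ) (x y : ℕ → ℝ) : Prop :=
  |(1 / (T.card : ℝ)) * ∑ t ∈ T, Real.logb 2 (fstMarginal p (x t))
      + diffEntropy (fstMarginal p)| < ε ∧
  |(1 / (T.card : ℝ)) * ∑ t ∈ T, Real.logb 2 (sndMarginal p (y t))
      + diffEntropy (sndMarginal p)| < ε ∧
  |(1 / (T.card : ℝ)) * ∑ t ∈ T, Real.logb 2 (p (x t, y t)) + diffEntropy p| < ε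

/-- The function `C(x) = (1/2) log₂ (1 + x)`. -/
def capacity (x : ℝ) : ℝ := (1 / 2) * Real.logb 2 (1 + x)

/-- The index of the other user. -/
def other (i : Fin 2) : Fin 2 := 1 - i

/-! ### The two-user Gaussian interference channel with stochastic data arrival -/

/-- The parameters of the system; the users are indexed by `Fin 2`. -/
structure System where
  /-- number of bits in an arriving packet -/
  k : Fin 2 → ℕ
  /-- number of transmitted codewords -/
  N : Fin 2 → ℕ
  /-- probability that a packet arrives in a time slot -/
  q : Fin 2 → unitInterval
  /-- scaled codeword length -/
  θ : Fin 2 → ℝ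
  /-- scaled activation time -/
  ν : Fin 2 → ℝ
  /-- variance of the codebook and preamble symbols -/
  γ : Fin 2 → ℝ≥0
  /-- squared gain of the link from a transmitter to the receiver of the other user -/
  a : Fin 2 → ℝ≥0
  /-- length of the preamble sequences, as a function of the scaling parameter `n` -/
  pre : ℕ → ℕ

namespace System

variable (S : System)

/-- `η_i = k_i / N_i` -/
def η (i : Fin 2) : ℝ := (S.k i : ℝ) / (S.N i : ℝ)

/-- The rate of data arrival `λ_i = k_i q_i`. -/
def rate (i : Fin 2) : ℝ := (S.k i : ℝ) * (S.q i : ℝ)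

/-- `μ_i = η_i / λ_i` -/
def μ (i : Fin 2) : ℝ := S.η i / S.rate i

/-- `φ_i = C(γ_i)` -/
def φ (i : Fin 2) : ℝ := capacity (S.γ i)

/-- `ψ_i = C(γ_i / (1 + a_{i'} γ_{i'}))` -/
def ψ (i : Fin 2) : ℝ := capacity ((S.γ i : ℝ) / (1 + S.a (other i) * S.γ (other i)))

/-- The codeword length `n_i = ⌊n θ_i⌋`. -/
def len (n : ℕ) (i : Fin 2) : ℕ := ⌊(n : ℝ) * S.θ i⌋₊

/-- The number `⌊n η_i⌋` of bits represented by a codeword. -/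
def bits (n : ℕ) (i : Fin 2) : ℕ := ⌊(n : ℝ) * S.η i⌋₊

/-- The activation time slot `⌊n ν_i⌋`. -/
def start (n : ℕ) (i : Fin 2) : ℕ := ⌊(n : ℝ) * S.ν i⌋₊

/-! #### Positions of the bursts on the scaled time axis

On the scaled time axis the `j`-th burst of user `i` occupies the interval
`(j μ_i + ν_i, j μ_i + ν_i + θ_i)`, and so does its codeword. -/

/-- Position of the `j'`-th burst of the other user relative to the `j`-th codeword of user `i`. -/
def offset (i : Fin 2) (j j' : ℕ) : ℝ :=
  (j' : ℝ) * S.μ (other i) - (j : ℝ) * S.μ i + S.ν (other i) - S.ν i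

/-- The index `ω⁻` of the burst of the other user that covers the left end of the `j`-th codeword
of user `i`; it is `0` (the infimum of the empty set) if there is none. -/
def omegaMinus (i : Fin 2) (j : ℕ) : ℕ :=
  sInf {j' | 1 ≤ j' ∧ j' ≤ S.N (other i) ∧
    -S.θ (other i) < S.offset i j j' ∧ S.offset i j j' < 0}

/-- The index `ω⁺` of the burst of the other user that covers the right end of the `j`-th codeword
of user `i`; it is `0` (the infimum of the empty set) if there is none. -/
def omegaPlus (i : Fin 2) (j : ℕ) : ℕ :=
  sInf {j' | 1 ≤ j' ∧ j' ≤ S.N (other i) ∧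
    S.θ i - S.θ (other i) < S.offset i j j' ∧ S.offset i j j' < S.θ i}

open Classical in
/-- The number `ω` of bursts of the other user that are completely contained within the `j`-th
codeword of user `i`. -/
def omega (i : Fin 2) (j : ℕ) : ℕ :=
  ((Finset.Icc 1 (S.N (other i))).filter fun j' =>
    0 < S.offset i j j' ∧ S.offset i j j' < S.θ i - S.θ (other i)).card

/-! #### Randomness -/

/-- A sample point: the packet arrivals of both users (one indicator per time slot), the two
codebooks, the two preamble sequences, and the noise at the two receivers. -/
abbrev Sample (n : ℕ) : Type :=
  (Fin 2 → ℕ → Bool) ×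
  ((i : Fin 2) → Fin (2 ^ S.bits n i) → Fin (S.len n i) → ℝ) ×
  (Fin 2 → Fin (S.pre n) → ℝ) ×
  (Fin 2 → ℕ → ℝ)

/-- The law of the sample: everything is independent; arrivals of user `i` are Bernoulli with
parameter `q_i`, codebook and preamble symbols of user `i` are centred Gaussian with variance `γ_i`,
noise symbols are standard Gaussian. -/
def law (n : ℕ) : Measure (S.Sample n) :=
  (Measure.pi fun i => Measure.infinitePi fun _ : ℕ => bernoulliMeasure true false (S.q i)).prod
  ((Measure.pi fun i => Measure.pi fun _ => Measure.pi fun _ => gaussianReal 0 (S.γ i)).prod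
  ((Measure.pi fun i => Measure.pi fun _ => gaussianReal 0 (S.γ i)).prod
  (Measure.pi fun _ => Measure.infinitePi fun _ : ℕ => gaussianReal 0 1)))

/-! #### Buffers and transmission times -/

/-- The number of bits generated by source `i` up to the end of time slot `t` when the arrivals are
`B`. The source starts at slot `⌊n ν_i⌋` and turns off once it has generated `k_i n` bits, that is,
`n` packets. -/
def generated (n : ℕ) (i : Fin 2) (B : ℕ → Bool) (t : ℕ) : ℕ :=
  S.k i * min n ((Finset.Icc (S.start n i) t).filter fun s => B s = true).card

/-- The number of bits in the buffer of user `i` at the end of slot `t`, if `⌊n η_i⌋` bits have been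
removed from it for each of the first `j` codewords. -/
def backlog (n : ℕ) (i : Fin 2) (B : ℕ → Bool) (j t : ℕ) : ℕ :=
  S.generated n i B t - j * S.bits n i

/-- The slot `τ_i^{(j)}`, at whose end the `j`-th codeword of user `i` is scheduled: the first slot,
not before the end of the previous burst, at whose end the buffer holds at least `⌊n η_i⌋` bits.
The `j`-th burst (`1 ≤ j ≤ N_i`) is sent in the slots `τ + 1, …, τ + n' + n_i`. -/
def burstTime (n : ℕ) (i : Fin 2) (B : ℕ → Bool) : ℕ → ℕ
  | 0 => S.start n i
  | j + 1 => sInf {t | (if j = 0 then S.start n i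
        else burstTime n i B j + S.pre n + S.len n i) ≤ t ∧ S.bits n i ≤ S.backlog n i B j t}

/-- `τ_i^{(j)}` as a random variable. -/
def τ (n : ℕ) (x : S.Sample n) (i : Fin 2) (j : ℕ) : ℕ := S.burstTime n i (x.1 i) j

/-! #### Transmitted and received signals -/

/-- An assignment of messages: `w i j` is the `j`-th message of user `i`. -/
abbrev Messages (n : ℕ) : Type := (i : Fin 2) → ℕ → Fin (2 ^ S.bits n i)

/-- The symbol number `l` (counted from `0`) of a burst: first the preamble, then the codeword. -/
def burstSymbol (n : ℕ) (i : Fin 2) (s' : Fin (S.pre n) → ℝ) (s : Fin (S.len n i) → ℝ)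
    (l : ℕ) : ℝ :=
  if h : l < S.pre n then s' ⟨l, h⟩
  else if h : l - S.pre n < S.len n i then s ⟨l - S.pre n, h⟩ else 0

/-- The symbol sent by user `i` in slot `t`; the bursts of a user occupy disjoint sets of slots,
and the transmitter is silent outside its bursts. -/
def signal (n : ℕ) (w : S.Messages n) (x : S.Sample n) (i : Fin 2) (t : ℕ) : ℝ :=
  ∑ j ∈ Finset.Icc 1 (S.N i),
    if S.τ n x i j + 1 ≤ t then
      S.burstSymbol n i (x.2.2.1 i) (x.2.1 i (w i j)) (t - (S.τ n x i j + 1))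
    else 0

/-- The signal received at receiver `i` in slot `t`. -/
def received (n : ℕ) (w : S.Messages n) (x : S.Sample n) (i : Fin 2) (t : ℕ) : ℝ :=
  S.signal n w x i t + Real.sqrt (S.a (other i)) * S.signal n w x (other i) t + x.2.2.2 i t

/-! #### The decoder

Receiver `i` knows the transmission times of both users. It treats interference as noise and tests
joint typicality separately on each segment of the codeword. -/

/-- The joint density of a sent and a received symbol in the absence of interference. -/
def clearDensity (i : Fin 2) (z : ℝ × ℝ) : ℝ :=
  gaussianPDFReal 0 (S.γ i) z.1 * gaussianPDFReal 0 1 (z.2 - z.1)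

/-- The joint density of a sent and a received symbol in the presence of interference. -/
def interferedDensity (i : Fin 2) (z : ℝ × ℝ) : ℝ :=
  gaussianPDFReal 0 (S.γ i) z.1 *
    gaussianPDFReal 0 (1 + S.a (other i) * S.γ (other i)) (z.2 - z.1)

/-- The slots in which the `j`-th codeword of user `i` is sent. -/
def window (n : ℕ) (x : S.Sample n) (i : Fin 2) (j : ℕ) : Finset ℕ :=
  Finset.Icc (S.τ n x i j + S.pre n + 1) (S.τ n x i j + S.pre n + S.len n i)

/-- The part of the codeword that overlaps with the `j'`-th burst of the other user. -/
def interferedSegment (n : ℕ) (x : S.Sample n) (i : Fin 2) (j j' : ℕ) : Finset ℕ :=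
  (S.window n x i j).filter fun t =>
    S.τ n x (other i) j' + 1 ≤ t ∧ t ≤ S.τ n x (other i) j' + S.pre n + S.len n (other i)

/-- The part of the codeword that lies after the `j'`-th and before the `(j'+1)`-st burst of the
other user (before the first burst if `j' = 0`, after the last burst if `j'` is its index). -/
def clearSegment (n : ℕ) (x : S.Sample n) (i : Fin 2) (j j' : ℕ) : Finset ℕ :=
  (S.window n x i j).filter fun t =>
    (j' = 0 ∨ S.τ n x (other i) j' + S.pre n + S.len n (other i) < t) ∧
    (j' = S.N (other i) ∨ t ≤ S.τ n x (other i) (j' + 1))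

/-- The codeword `s`, placed at the slots in which the `j`-th codeword of user `i` is sent. -/
def placed (n : ℕ) (x : S.Sample n) (i : Fin 2) (j : ℕ) (s : Fin (S.len n i) → ℝ) (t : ℕ) : ℝ :=
  if h : t - (S.τ n x i j + S.pre n + 1) < S.len n i then
    s ⟨t - (S.τ n x i j + S.pre n + 1), h⟩
  else 0

/-- The candidate message `m` passes the test of receiver `i` for the `j`-th codeword: on every
nonempty segment its codeword and the received signal are jointly typical with respect to the
density of that segment. -/
def Passes (n : ℕ) (ε : ℝ) (w : S.Messages n) (x : S.Sample n) (i : Fin 2) (j : ℕ)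
    (m : Fin (2 ^ S.bits n i)) : Prop :=
  (∀ j', 1 ≤ j' → j' ≤ S.N (other i) → (S.interferedSegment n x i j j').Nonempty →
    JointlyTypical ε (S.interferedDensity i) (S.interferedSegment n x i j j')
      (S.placed n x i j (x.2.1 i m)) (S.received n w x i)) ∧
  (∀ j', j' ≤ S.N (other i) → (S.clearSegment n x i j j').Nonempty →
    JointlyTypical ε (S.clearDensity i) (S.clearSegment n x i j j')
      (S.placed n x i j (x.2.1 i m)) (S.received n w x i))

/-- The probability that the transmitted message is not the unique one that passes the test. -/
def errorProb (n : ℕ) (ε : ℝ) (w : S.Messages n) (i : Fin 2) (j : ℕ) : ℝ≥0∞ :=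
  S.law n {x | ¬ ∀ m, S.Passes n ε w x i j m ↔ m = w i j}

/-- The `j`-th message of user `i` is decoded reliably: if the typicality parameter is small enough,
then the probability of error tends to zero, whatever the messages are. -/
def ReliablyDecoded (i : Fin 2) (j : ℕ) : Prop :=
  ∃ ε₀ : ℝ, 0 < ε₀ ∧ ∀ ε : ℝ, 0 < ε → ε < ε₀ → ∀ w : (n : ℕ) → S.Messages n,
    Tendsto (fun n => S.errorProb n ε (w n) i j) atTop (𝓝 0)

end System

end GICSDA

end

noncomputable section

namespace GICSDA

/-! ### Gaussian densities and typicality -/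

/-! Given the arrivals, receiver `i` sees the codeword through a concatenation of Gaussian channels,
one per segment, with mutual information `ψ i` per slot under interference and `φ i` without. Random
coding works as soon as the number of bits stays below the total mutual information. On the scaled
axis this reads `η i < θ i * ψ i + (φ i - ψ i) * C`, where `C` is the total scaled length of the
clear segments (`Regular.reliablyDecoded`). The theorem is then a lower bound on `C`. If two
different bursts cover the two ends of the codeword, at least `1 + ω` complete gaps of length `μ' -
θ'` lie inside it (`Regular.le_sum_gapLength`), which gives (1); for (2), `0 ≤ C` is enough.

Geometry: by the weak law of large numbers `τ / n` tends in probability to `ν + j μ`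
(`tendsto_burstTime_div`). The excluded offsets keep the limits of the two ends of each segment
apart, so with probability tending to one each segment is either empty or of length at least `κ n`.

Errors, for fixed arrivals: the sent codeword fails a test only if some average of squares of
Gaussians deviates from its mean, which Chebyshev's inequality controls on each segment separately
(`measure_not_jointlyTypical_codeword_le`). Independence between segments is neither needed nor
available, since all bursts of a user share one preamble. A wrong codeword that passes has a
likelihood ratio of at least `2 ^ exponent`. It is independent of the output, and for every fixed
output the ratio has mean one, so Markov's inequality and a union bound over the messages suffice
(`measure_passes_le`). The law of the output plays no role there.

The error event depends on the arrivals only through finitely many integers, the burst times. This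
allows the conditional bounds to be combined without measurability of that event
(`measure_prod_le_of_slices`). -/

/-- The joint density of a centred Gaussian input of variance `γ` and the output of the channel
that adds an independent centred Gaussian of variance `σ`. -/
def pairDensity (γ σ : ℝ≥0) (z : ℝ × ℝ) : ℝ :=
  gaussianPDFReal 0 γ z.1 * gaussianPDFReal 0 σ (z.2 - z.1)

lemma gaussianPDFReal_zero_apply (v : ℝ≥0) (x : ℝ) :
    gaussianPDFReal 0 v x = (√(2 * Real.pi * v))⁻¹ * Real.exp (-x ^ 2 / (2 * v)) := by
  simp [gaussianPDFReal_def]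

/-- Completing the square in `x`: the second factor is the posterior density of the input given the
output `y`. Since it integrates to one, this yields both the output marginal and
`lintegral_densityRatio`. -/
lemma pairDensity_eq_mul {γ σ : ℝ≥0} (hγ : γ ≠ 0) (hσ : σ ≠ 0) (x y : ℝ) :
    pairDensity γ σ (x, y) = gaussianPDFReal 0 (γ + σ) y *
      gaussianPDFReal (γ / (γ + σ) * y) (γ * σ / (γ + σ)) x := by
  have hγ' : (0 : ℝ) < γ := by positivity
  have hσ' : (0 : ℝ) < σ := by positivity
  simp only [pairDensity, gaussianPDFReal_def]
  push_cast
  rw [mul_mul_mul_comm, ← Real.exp_add, mul_mul_mul_comm, ← Real.exp_add]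
  congr 1
  · rw [← mul_inv, ← mul_inv, ← Real.sqrt_mul (by positivity), ← Real.sqrt_mul (by positivity)]
    congr 2
    field_simp
  · congr 1
    field_simp
    ring

lemma fstMarginal_pairDensity {γ σ : ℝ≥0} (hσ : σ ≠ 0) :
    fstMarginal (pairDensity γ σ) = gaussianPDFReal 0 γ := by
  ext x
  simp only [fstMarginal, pairDensity]
  rw [integral_const_mul, integral_sub_right_eq_self (fun y => gaussianPDFReal 0 σ y) x,
    integral_gaussianPDFReal_eq_one _ hσ, mul_one]

lemma sndMarginal_pairDensity {γ σ : ℝ≥0} (hγ : γ ≠ 0) (hσ : σ ≠ 0) :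
    sndMarginal (pairDensity γ σ) = gaussianPDFReal 0 (γ + σ) := by
  ext y
  simp only [sndMarginal, pairDensity_eq_mul hγ hσ]
  rw [integral_const_mul, integral_gaussianPDFReal_eq_one _ (by positivity), mul_one]

lemma logb_gaussianPDFReal {v : ℝ≥0} (hv : v ≠ 0) (x : ℝ) :
    Real.logb 2 (gaussianPDFReal 0 v x)
      = -(1 / 2) * Real.logb 2 (2 * Real.pi * v) - (1 / (2 * Real.log 2)) * (x ^ 2 / v) := by
  have hv' : (0 : ℝ) < v := by positivity
  have h2 : Real.log 2 ≠ 0 := (Real.log_pos one_lt_two).ne'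
  rw [gaussianPDFReal_zero_apply, Real.logb, Real.logb, Real.log_mul (by positivity) (by positivity),
    Real.log_inv, Real.log_sqrt (by positivity), Real.log_exp]
  field_simp
  ring

lemma integral_sq_gaussianReal (v : ℝ≥0) : ∫ x, x ^ 2 ∂(gaussianReal 0 v) = v := by
  have h := variance_fun_id_gaussianReal (μ := 0) (v := v)
  rw [variance_eq_integral (by fun_prop)] at h
  simpa using h

lemma integrable_sq_gaussianReal (v : ℝ≥0) : Integrable (fun x => x ^ 2) (gaussianReal 0 v) := by
  simpa using (memLp_id_gaussianReal (μ := 0) (v := v) 2).integrable_sq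

lemma integral_gaussianPDFReal_mul {v : ℝ≥0} (hv : v ≠ 0) (f : ℝ → ℝ) :
    ∫ x, gaussianPDFReal 0 v x * f x = ∫ x, f x ∂(gaussianReal 0 v) := by
  simp [integral_gaussianReal_eq_integral_smul hv]

lemma integrable_gaussianPDFReal_mul {v : ℝ≥0} (hv : v ≠ 0) {f : ℝ → ℝ}
    (hf : Integrable f (gaussianReal 0 v)) :
    Integrable (fun x => gaussianPDFReal 0 v x * f x) := by
  rw [gaussianReal_of_var_ne_zero _ hv, integrable_withDensity_iff_integrable_smul'
    (measurable_gaussianPDF 0 v) (by simp [gaussianPDF])] at hf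
  simpa [toReal_gaussianPDF] using hf

lemma integrable_logb_gaussianPDFReal {v : ℝ≥0} (hv : v ≠ 0) :
    Integrable (fun x => Real.logb 2 (gaussianPDFReal 0 v x)) (gaussianReal 0 v) := by
  simp only [logb_gaussianPDFReal hv]
  exact (integrable_const _).sub (((integrable_sq_gaussianReal v).div_const _).const_mul _)

lemma diffEntropy_gaussianPDFReal {v : ℝ≥0} (hv : v ≠ 0) :
    diffEntropy (gaussianPDFReal 0 v)
      = (1 / 2) * Real.logb 2 (2 * Real.pi * v) + 1 / (2 * Real.log 2) := by
  have hv' : (0 : ℝ) < v := by positivity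
  rw [diffEntropy, integral_gaussianPDFReal_mul hv]
  simp only [logb_gaussianPDFReal hv]
  rw [integral_sub (integrable_const _) (((integrable_sq_gaussianReal v).div_const _).const_mul _),
    integral_const, integral_const_mul, integral_div, integral_sq_gaussianReal]
  simp
  field_simp
  ring

/-- The shear `(x, z) ↦ (x, x + z)` preserves Lebesgue measure and turns the pair density into the
product of input and noise densities, whose logarithm splits. -/
lemma diffEntropy_pairDensity {γ σ : ℝ≥0} (hγ : γ ≠ 0) (hσ : σ ≠ 0) :
    diffEntropy (pairDensity γ σ)
      = diffEntropy (gaussianPDFReal 0 γ) + diffEntropy (gaussianPDFReal 0 σ) := by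
  set G := gaussianPDFReal 0 γ with hG
  set H := gaussianPDFReal 0 σ with hH
  have hmp := measurePreserving_prod_add (volume : Measure ℝ) (volume : Measure ℝ)
  have hemb : MeasurableEmbedding (fun z : ℝ × ℝ => (z.1, z.1 + z.2)) :=
    (MeasurableEquiv.shearAddRight ℝ).measurableEmbedding
  have key := hmp.integral_comp hemb
    (fun z => pairDensity γ σ z * Real.logb 2 (pairDensity γ σ z))
  rw [diffEntropy, Measure.volume_eq_prod, ← key]
  have hsplit : ∀ z : ℝ × ℝ, pairDensity γ σ (z.1, z.1 + z.2) *
      Real.logb 2 (pairDensity γ σ (z.1, z.1 + z.2)) =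
      (G z.1 * Real.logb 2 (G z.1)) * H z.2 + G z.1 * (H z.2 * Real.logb 2 (H z.2)) := by
    intro z
    simp only [pairDensity, add_sub_cancel_left, ← hG, ← hH]
    rw [Real.logb_mul (gaussianPDFReal_pos _ _ _ hγ).ne' (gaussianPDFReal_pos _ _ _ hσ).ne']
    ring
  simp only [hsplit]
  have iG : Integrable (fun x => G x * Real.logb 2 (G x)) :=
    integrable_gaussianPDFReal_mul hγ (integrable_logb_gaussianPDFReal hγ)
  have iH : Integrable (fun x => H x * Real.logb 2 (H x)) :=
    integrable_gaussianPDFReal_mul hσ (integrable_logb_gaussianPDFReal hσ)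
  rw [integral_add (iG.mul_prod (integrable_gaussianPDFReal 0 σ))
    ((integrable_gaussianPDFReal 0 γ).mul_prod iH),
    integral_prod_mul (fun x => G x * Real.logb 2 (G x)) H,
    integral_prod_mul G (fun x => H x * Real.logb 2 (H x)),
    integral_gaussianPDFReal_eq_one _ hγ, integral_gaussianPDFReal_eq_one _ hσ,
    diffEntropy, diffEntropy]
  ring

/-! ### Typicality as a condition on mean squares -/

/-- The average deviation of the squares of `u`, in units of `v`, from `1`. -/
def sqDeviation (T : Finset ℕ) (v : ℝ) (u : ℕ → ℝ) : ℝ :=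
  (1 / (T.card : ℝ)) * ∑ t ∈ T, (u t ^ 2 / v - 1)

/-- The logarithm of a Gaussian density is affine in the square of its argument and the entropy is
minus its mean, so all constants cancel. -/
lemma average_logb_gaussianPDFReal_add_diffEntropy {T : Finset ℕ} (hT : T.Nonempty) {v : ℝ≥0}
    (hv : v ≠ 0) (u : ℕ → ℝ) :
    (1 / (T.card : ℝ)) * ∑ t ∈ T, Real.logb 2 (gaussianPDFReal 0 v (u t))
      + diffEntropy (gaussianPDFReal 0 v) = -(1 / (2 * Real.log 2)) * sqDeviation T v u := by
  have hc : (T.card : ℝ) ≠ 0 := by simpa using hT.ne_empty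
  have h2 : Real.log 2 ≠ 0 := (Real.log_pos one_lt_two).ne'
  simp only [logb_gaussianPDFReal hv, diffEntropy_gaussianPDFReal hv, sqDeviation,
    Finset.sum_sub_distrib, Finset.sum_const, nsmul_eq_mul, ← Finset.mul_sum]
  field_simp
  ring

lemma logb_pairDensity {γ σ : ℝ≥0} (hγ : γ ≠ 0) (hσ : σ ≠ 0) (x y : ℝ) :
    Real.logb 2 (pairDensity γ σ (x, y)) =
      Real.logb 2 (gaussianPDFReal 0 γ x) + Real.logb 2 (gaussianPDFReal 0 σ (y - x)) :=
  Real.logb_mul (gaussianPDFReal_pos _ _ _ hγ).ne' (gaussianPDFReal_pos _ _ _ hσ).ne'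

/-- The joint condition is the sum of an input part and a noise part. The threshold `log 2 * ε`
makes each of them smaller than `ε / 2`. -/
lemma jointlyTypical_of_sqDeviation_lt {T : Finset ℕ} (hT : T.Nonempty) {γ σ : ℝ≥0} (hγ : γ ≠ 0)
    (hσ : σ ≠ 0) {ε : ℝ} {x y : ℕ → ℝ}
    (h1 : |sqDeviation T γ x| < Real.log 2 * ε)
    (h2 : |sqDeviation T (γ + σ : ℝ≥0) y| < Real.log 2 * ε)
    (h3 : |sqDeviation T σ (fun t => y t - x t)| < Real.log 2 * ε) :
    JointlyTypical ε (pairDensity γ σ) T x y := by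
  have hl : 0 < Real.log 2 := Real.log_pos one_lt_two
  have half : ∀ {d : ℝ}, |d| < Real.log 2 * ε → |-(1 / (2 * Real.log 2)) * d| < ε / 2 := by
    intro d hd
    rw [abs_mul, abs_neg, abs_of_pos (by positivity : (0 : ℝ) < 1 / (2 * Real.log 2))]
    calc 1 / (2 * Real.log 2) * |d| < 1 / (2 * Real.log 2) * (Real.log 2 * ε) := by gcongr
      _ = ε / 2 := by field_simp
  have hε : 0 < ε := by
    have := (abs_nonneg _).trans_lt h1
    exact pos_of_mul_pos_right this hl.le
  have e1 := average_logb_gaussianPDFReal_add_diffEntropy hT hγ x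
  have e2 := average_logb_gaussianPDFReal_add_diffEntropy hT (v := γ + σ) (by positivity) y
  have e3 := average_logb_gaussianPDFReal_add_diffEntropy hT hσ (fun t => y t - x t)
  refine ⟨?_, ?_, ?_⟩
  · rw [fstMarginal_pairDensity hσ, e1]
    linarith [half h1]
  · rw [sndMarginal_pairDensity hγ hσ, e2]
    linarith [half h2]
  · have : (1 / (T.card : ℝ)) * ∑ t ∈ T, Real.logb 2 (pairDensity γ σ (x t, y t))
        + diffEntropy (pairDensity γ σ) = -(1 / (2 * Real.log 2)) * sqDeviation T γ x +
          -(1 / (2 * Real.log 2)) * sqDeviation T σ (fun t => y t - x t) := by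
      rw [← e1, ← e3, diffEntropy_pairDensity hγ hσ]
      simp only [logb_pairDensity hγ hσ, Finset.sum_add_distrib]
      ring
    rw [this]
    exact (abs_add_le _ _).trans_lt (by linarith [half h1, half h3])

/-! ### The likelihood ratio of a codeword -/

/-- The ratio of the joint density to the product of its marginals. -/
def densityRatio (γ σ : ℝ≥0) (x y : ℝ) : ℝ :=
  gaussianPDFReal 0 σ (y - x) / gaussianPDFReal 0 (γ + σ) y

lemma densityRatio_pos {γ σ : ℝ≥0} (hσ : σ ≠ 0) (x y : ℝ) : 0 < densityRatio γ σ x y :=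
  div_pos (gaussianPDFReal_pos _ _ _ hσ) (gaussianPDFReal_pos _ _ _ (by positivity))

lemma logb_densityRatio {γ σ : ℝ≥0} (hσ : σ ≠ 0) (x y : ℝ) :
    Real.logb 2 (densityRatio γ σ x y) = Real.logb 2 (gaussianPDFReal 0 σ (y - x)) -
      Real.logb 2 (gaussianPDFReal 0 (γ + σ) y) :=
  Real.logb_div (gaussianPDFReal_pos _ _ _ hσ).ne'
    (gaussianPDFReal_pos _ _ _ (by positivity)).ne'

/-- Input density times ratio is the posterior density of the input given `y`. The mean is therefore
one for each individual `y`, whatever its distribution. -/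
lemma lintegral_densityRatio {γ σ : ℝ≥0} (hγ : γ ≠ 0) (hσ : σ ≠ 0) (y : ℝ) :
    ∫⁻ x, ENNReal.ofReal (densityRatio γ σ x y) ∂(gaussianReal 0 γ) = 1 := by
  have hm : Measurable fun x => densityRatio γ σ x y  := by
    unfold densityRatio; fun_prop
  have hg : Measurable (gaussianPDF 0 γ) := measurable_gaussianPDF 0 γ
  rw [gaussianReal_of_var_ne_zero 0 hγ, lintegral_withDensity_eq_lintegral_mul volume
    hg hm.ennreal_ofReal]
  have hv : γ * σ / (γ + σ) ≠ 0 := by positivity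
  have : ∀ x, (gaussianPDF 0 γ * fun x => ENNReal.ofReal (densityRatio γ σ x y)) x
      = gaussianPDF (γ / (γ + σ) * y) (γ * σ / (γ + σ)) x := by
    intro x
    have hp := pairDensity_eq_mul hγ hσ x y
    have hy : gaussianPDFReal 0 (γ + σ) y ≠ 0 := (gaussianPDFReal_pos _ _ _ (by positivity)).ne'
    rw [Pi.mul_apply, gaussianPDF, gaussianPDF, ← ENNReal.ofReal_mul (gaussianPDFReal_nonneg _ _ _)]
    rw [pairDensity] at hp
    rw [densityRatio, ← mul_div_assoc, hp, mul_div_cancel_left₀ _ hy]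
  rw [lintegral_congr this, lintegral_gaussianPDF_eq_one _ hv]

/-- The log ratio is the joint log density minus the two marginal ones, and `capacity (γ / σ)` is
the corresponding combination of entropies. Each of the three typicality conditions costs one `ε`.
-/
lemma JointlyTypical.le_sum_logb_densityRatio {T : Finset ℕ} (hT : T.Nonempty) {γ σ : ℝ≥0}
    (hγ : γ ≠ 0) (hσ : σ ≠ 0) {ε : ℝ} {x y : ℕ → ℝ}
    (h : JointlyTypical ε (pairDensity γ σ) T x y) :
    (T.card : ℝ) * (capacity (γ / σ) - 3 * ε)
      ≤ ∑ t ∈ T, Real.logb 2 (densityRatio γ σ (x t) (y t)) := by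
  obtain ⟨h1, h2, h3⟩ := h
  rw [fstMarginal_pairDensity hσ] at h1
  rw [sndMarginal_pairDensity hγ hσ] at h2
  have hσ' : (0 : ℝ) < σ := by positivity
  have hγ' : (0 : ℝ) < γ := by positivity
  have hc : (0 : ℝ) < T.card := by exact_mod_cast hT.card_pos
  have hcap : capacity (γ / σ) = diffEntropy (gaussianPDFReal 0 γ) +
      diffEntropy (gaussianPDFReal 0 (γ + σ)) - diffEntropy (pairDensity γ σ) := by
    rw [diffEntropy_pairDensity hγ hσ, diffEntropy_gaussianPDFReal hσ,
      diffEntropy_gaussianPDFReal (v := γ + σ) (by positivity), capacity,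
      show 1 + (γ : ℝ) / σ = (2 * Real.pi * (γ + σ : ℝ≥0)) / (2 * Real.pi * σ) by
        push_cast; field_simp; ring, Real.logb_div (by positivity) (by positivity)]
    ring
  have hsum : (1 / (T.card : ℝ)) * ∑ t ∈ T, Real.logb 2 (densityRatio γ σ (x t) (y t)) =
      (1 / (T.card : ℝ)) * ∑ t ∈ T, Real.logb 2 (pairDensity γ σ (x t, y t)) -
      (1 / (T.card : ℝ)) * ∑ t ∈ T, Real.logb 2 (gaussianPDFReal 0 γ (x t)) -
      (1 / (T.card : ℝ)) * ∑ t ∈ T, Real.logb 2 (gaussianPDFReal 0 (γ + σ) (y t)) := by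
    simp only [logb_densityRatio hσ, logb_pairDensity hγ hσ, Finset.sum_add_distrib,
      Finset.sum_sub_distrib]
    ring
  rw [abs_lt] at h1 h2 h3
  have : capacity (γ / σ) - 3 * ε ≤
      (1 / (T.card : ℝ)) * ∑ t ∈ T, Real.logb 2 (densityRatio γ σ (x t) (y t)) := by
    rw [hsum, hcap]
    linarith [h1.2, h2.2, h3.1]
  calc (T.card : ℝ) * (capacity (γ / σ) - 3 * ε)
      ≤ T.card * ((1 / (T.card : ℝ)) * ∑ t ∈ T, Real.logb 2 (densityRatio γ σ (x t) (y t))) := by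
        gcongr
    _ = _ := by field_simp

/-! ### Concentration of sums and independence of jointly Gaussian coordinates -/

/-- Chebyshev's inequality; pairwise independence suffices for the variances to add. -/
lemma measure_abs_sum_sub_ge_le {Ω ι : Type*} [MeasurableSpace Ω] {P : Measure Ω}
    [IsProbabilityMeasure P] {X : ι → Ω → ℝ} {T : Finset ι} {m V c : ℝ}
    (hL : ∀ t ∈ T, MemLp (X t) 2 P) (hE : ∀ t ∈ T, ∫ ω, X t ω ∂P = m)
    (hV : ∀ t ∈ T, Var[X t; P] = V)
    (hind : (T : Set ι).Pairwise fun s t => IndepFun (X s) (X t) P) (hc : 0 < c) :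
    P {ω | c ≤ |∑ t ∈ T, X t ω - T.card * m|} ≤ ENNReal.ofReal (T.card * V / c ^ 2) := by
  have hS : MemLp (∑ t ∈ T, X t) 2 P := memLp_finsetSum' _ hL
  have h := meas_ge_le_variance_div_sq hS hc
  have hmean : ∫ ω, (∑ t ∈ T, X t) ω ∂P = T.card * m := by
    simp only [Finset.sum_apply]
    rw [integral_finsetSum _ fun t ht => (hL t ht).integrable one_le_two,
      Finset.sum_congr rfl hE, Finset.sum_const, nsmul_eq_mul]
  rw [hmean, IndepFun.variance_sum hL hind, Finset.sum_congr rfl hV, Finset.sum_const,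
    nsmul_eq_mul] at h
  simpa only [Finset.sum_apply] using h

/-- The variance of the normalized square of a centred Gaussian of variance `v`. -/
def sqVariance (v : ℝ≥0) : ℝ := Var[fun x => x ^ 2 / (v : ℝ); gaussianReal 0 v]

lemma sqVariance_nonneg (v : ℝ≥0) : 0 ≤ sqVariance v := variance_nonneg _ _

lemma memLp_sq_gaussianReal (v : ℝ≥0) : MemLp (fun x : ℝ => x ^ 2) 2 (gaussianReal 0 v) := by
  have h : MemLp (fun x : ℝ => x) 4 (gaussianReal 0 v) := memLp_id_gaussianReal (μ := 0) (v := v) 4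
  have : ENNReal.HolderTriple 4 4 2 := ⟨by
    have h4 : (4 : ℝ≥0∞) = 2 * 2 := by norm_num
    rw [h4, ENNReal.mul_inv (by simp) (by simp), ← mul_add, ENNReal.inv_two_add_inv_two, mul_one]⟩
  simpa only [sq] using h.mul' (r := 2) h

lemma measure_le_abs_sqDeviation_le {Ω : Type*} [MeasurableSpace Ω] {P : Measure Ω}
    [IsProbabilityMeasure P] {u : ℕ → Ω → ℝ} {T : Finset ℕ} (hT : T.Nonempty) {v : ℝ≥0}
    (hv : v ≠ 0) (hm : ∀ t ∈ T, Measurable (u t)) (hlaw : ∀ t ∈ T, P.map (u t) = gaussianReal 0 v)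
    (hind : (T : Set ℕ).Pairwise fun s t => IndepFun (u s) (u t) P) {δ : ℝ} (hδ : 0 < δ) :
    P {ω | δ ≤ |sqDeviation T v (fun t => u t ω)|}
      ≤ ENNReal.ofReal (sqVariance v / (T.card * δ ^ 2)) := by
  have hc : (0 : ℝ) < T.card := by exact_mod_cast hT.card_pos
  have hv' : (v : ℝ) ≠ 0 := by exact_mod_cast hv
  have hf : MemLp (fun x : ℝ => x ^ 2 / (v : ℝ)) 2 (gaussianReal 0 v) := by
    simpa only [div_eq_inv_mul] using (memLp_sq_gaussianReal v).const_mul (v : ℝ)⁻¹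
  have hfm : Measurable (fun x : ℝ => x ^ 2 / (v : ℝ)) := by fun_prop
  have key := measure_abs_sum_sub_ge_le (P := P) (X := fun t ω => u t ω ^ 2 / (v : ℝ)) (T := T)
    (m := 1) (V := sqVariance v) (c := T.card * δ) ?_ ?_ ?_ ?_ (by positivity)
  · refine (measure_mono ?_).trans (key.trans_eq ?_)
    · intro ω hω
      simp only [Set.mem_ofPred_eq, sqDeviation, Finset.sum_sub_distrib, Finset.sum_const,
        nsmul_eq_mul] at hω ⊢
      rw [abs_mul, abs_of_pos (by positivity : (0 : ℝ) < 1 / T.card)] at hω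
      calc (T.card : ℝ) * δ ≤ T.card * (1 / T.card * _) := by gcongr
        _ = _ := by field_simp
    · congr 1
      field_simp
  · intro t ht
    rw [← hlaw t ht] at hf
    exact (memLp_map_measure_iff hf.1 (hm t ht).aemeasurable).1 hf
  · intro t ht
    have := integral_map (hm t ht).aemeasurable (f := fun x : ℝ => x ^ 2 / (v : ℝ))
      (μ := P) hfm.aestronglyMeasurable
    rw [← this, hlaw t ht, integral_div, integral_sq_gaussianReal, div_self hv']
  · intro t ht
    have := variance_map (Y := u t) (μ := P) (X := fun x : ℝ => x ^ 2 / (v : ℝ))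
      hfm.aemeasurable (hm t ht).aemeasurable
    rw [hlaw t ht] at this
    exact this.symm
  · intro s hs t ht hst
    exact (hind hs ht hst).comp hfm hfm

section Coordinates

variable {Ω κ : Type*} [MeasurableSpace Ω] {P : Measure Ω} {Y : κ → Ω → ℝ}

lemma map_const_mul_add {v : κ → ℝ≥0} (hY : iIndepFun Y P) (hm : ∀ k, Measurable (Y k))
    (hv : ∀ k, P.map (Y k) = gaussianReal 0 (v k)) (g : ℝ≥0) {b c : κ} (hbc : b ≠ c) :
    P.map (fun ω => √(g : ℝ) * Y b ω + Y c ω) = gaussianReal 0 (g * v b + v c) := by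
  have h1 : P.map (fun ω => √(g : ℝ) * Y b ω) = gaussianReal 0 (g * v b) := by
    rw [← Function.comp_def (fun x => √(g : ℝ) * x) (Y b), ← Measure.map_map (by fun_prop) (hm b),
      hv, gaussianReal_map_const_mul]
    congr 1
    · simp
    · ext; simp
  have := gaussianReal_add_gaussianReal_of_indepFun
    ((hY.indepFun hbc).comp (measurable_const_mul √(g : ℝ)) measurable_id) h1 (hv c)
  rw [add_zero] at this
  exact this

lemma map_add_const_mul_add {v : κ → ℝ≥0} (hY : iIndepFun Y P) (hm : ∀ k, Measurable (Y k))
    (hv : ∀ k, P.map (Y k) = gaussianReal 0 (v k)) (g : ℝ≥0) {a b c : κ} (hab : a ≠ b)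
    (hac : a ≠ c) (hbc : b ≠ c) :
    P.map (fun ω => Y a ω + √(g : ℝ) * Y b ω + Y c ω)
      = gaussianReal 0 (v a + (g * v b + v c)) := by
  have hind : IndepFun (Y a) (fun ω => √(g : ℝ) * Y b ω + Y c ω) P :=
    ((hY.indepFun_prodMk hm b c a hab.symm hac.symm).comp
      (φ := fun z : ℝ × ℝ => √(g : ℝ) * z.1 + z.2) (by fun_prop) measurable_id).symm
  have := gaussianReal_add_gaussianReal_of_indepFun hind (hv a) (map_const_mul_add hY hm hv g hbc)
  simp only [add_zero] at this
  rw [← this]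
  congr 1
  ext ω
  simp [add_assoc]

lemma indepFun_of_disjoint_triples [DecidableEq κ] (hY : iIndepFun Y P)
    (hm : ∀ k, Measurable (Y k)) {a b c a' b' c' : κ}
    (hd : Disjoint ({a, b, c} : Finset κ) {a', b', c'}) {f : ℝ × ℝ × ℝ → ℝ} (hf : Measurable f) :
    IndepFun (fun ω => f (Y a ω, Y b ω, Y c ω)) (fun ω => f (Y a' ω, Y b' ω, Y c' ω)) P := by
  refine (hY.indepFun_finset _ _ hd hm).comp
    (φ := fun z => f (z ⟨a, by simp⟩, z ⟨b, by simp⟩, z ⟨c, by simp⟩))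
    (ψ := fun z => f (z ⟨a', by simp⟩, z ⟨b', by simp⟩, z ⟨c', by simp⟩)) ?_ ?_ <;>
  exact hf.comp (by fun_prop)

/-- A sent codeword and the output of an additive Gaussian channel are jointly typical with high
probability. -/
lemma measure_not_jointlyTypical_le [DecidableEq κ] {v : κ → ℝ≥0} (hY : iIndepFun Y P)
    (hm : ∀ k, Measurable (Y k)) (hv : ∀ k, P.map (Y k) = gaussianReal 0 (v k))
    {T : Finset ℕ} (hT : T.Nonempty) {γ σ : ℝ≥0} (hγ : γ ≠ 0) (hσ : σ ≠ 0) (g : ℝ≥0)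
    {a b c : ℕ → κ} (hab : ∀ t ∈ T, a t ≠ b t) (hac : ∀ t ∈ T, a t ≠ c t)
    (hbc : ∀ t ∈ T, b t ≠ c t) (hva : ∀ t ∈ T, v (a t) = γ)
    (hvbc : ∀ t ∈ T, g * v (b t) + v (c t) = σ)
    (hd : ∀ s ∈ T, ∀ t ∈ T, s ≠ t → Disjoint ({a s, b s, c s} : Finset κ) {a t, b t, c t})
    {ε : ℝ} (hε : 0 < ε) :
    P {ω | ¬ JointlyTypical ε (pairDensity γ σ) T (fun t => Y (a t) ω)
        (fun t => Y (a t) ω + √(g : ℝ) * Y (b t) ω + Y (c t) ω)}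
      ≤ ENNReal.ofReal ((sqVariance γ + sqVariance (γ + σ) + sqVariance σ) /
          (T.card * (Real.log 2 * ε) ^ 2)) := by
  have := hY.isProbabilityMeasure
  have hl : 0 < Real.log 2 := Real.log_pos one_lt_two
  have hδ : 0 < Real.log 2 * ε := by positivity
  -- Different slots use disjoint triples of symbols, so any function of the triple is pairwise
  -- independent over the slots. It is applied to the input, the output and the noise with
  -- interference.
  have hind : ∀ {f : ℝ × ℝ × ℝ → ℝ}, Measurable f → (T : Set ℕ).Pairwise fun s t =>
      IndepFun (fun ω => f (Y (a s) ω, Y (b s) ω, Y (c s) ω))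
        (fun ω => f (Y (a t) ω, Y (b t) ω, Y (c t) ω)) P := fun hf s hs t ht hst =>
    indepFun_of_disjoint_triples hY hm (hd s hs t ht hst) hf
  have h1 := measure_le_abs_sqDeviation_le (P := P) (u := fun t => Y (a t)) hT hγ
    (fun t _ => hm _) (fun t ht => by rw [hv, hva t ht])
    (hind (f := fun z => z.1) (by fun_prop)) hδ
  have h2 := measure_le_abs_sqDeviation_le (P := P)
    (u := fun t ω => Y (a t) ω + √(g : ℝ) * Y (b t) ω + Y (c t) ω) hT
    (v := γ + σ) (by positivity) (fun t _ => by fun_prop)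
    (fun t ht => by
      rw [map_add_const_mul_add hY hm hv g (hab t ht) (hac t ht) (hbc t ht), hva t ht, hvbc t ht])
    (hind (f := fun z => z.1 + √(g : ℝ) * z.2.1 + z.2.2) (by fun_prop)) hδ
  have h3 := measure_le_abs_sqDeviation_le (P := P)
    (u := fun t ω => √(g : ℝ) * Y (b t) ω + Y (c t) ω) hT hσ (fun t _ => by fun_prop)
    (fun t ht => by rw [map_const_mul_add hY hm hv g (hbc t ht), hvbc t ht])
    (hind (f := fun z => √(g : ℝ) * z.2.1 + z.2.2) (by fun_prop)) hδ
  have hsum : (sqVariance γ + sqVariance (γ + σ) + sqVariance σ) /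
      (T.card * (Real.log 2 * ε) ^ 2) = sqVariance γ / (T.card * (Real.log 2 * ε) ^ 2) +
      sqVariance (γ + σ) / (T.card * (Real.log 2 * ε) ^ 2) +
      sqVariance σ / (T.card * (Real.log 2 * ε) ^ 2) := by ring
  have n1 := sqVariance_nonneg γ
  have n2 := sqVariance_nonneg (γ + σ)
  have n3 := sqVariance_nonneg σ
  rw [hsum, ENNReal.ofReal_add (by positivity) (by positivity),
    ENNReal.ofReal_add (by positivity) (by positivity)]
  refine le_trans ?_ (add_le_add (add_le_add h1 h2) h3)
  refine (measure_mono ?_).trans ((measure_union_le _ _).trans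
    (add_le_add_left (measure_union_le _ _) _))
  intro ω hω
  by_contra hcon
  simp only [Set.mem_union, Set.mem_ofPred_eq, not_or, not_le] at hcon
  refine hω (jointlyTypical_of_sqDeviation_lt hT hγ hσ hcon.1.1 hcon.1.2 ?_)
  simpa only [add_assoc, add_sub_cancel_left] using hcon.2

/-- A codeword that is independent of the received signal has a small likelihood ratio. -/
lemma measure_le_sum_logb_densityRatio_le [DecidableEq κ] {γ : ℝ≥0} (hγ : γ ≠ 0) {σ : ℕ → ℝ≥0}
    (hσ : ∀ t, σ t ≠ 0) (hY : iIndepFun Y P) (hm : ∀ k, Measurable (Y k)) {W : Finset ℕ}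
    {a : ℕ → κ} (ha : Set.InjOn a W) (hlaw : ∀ t ∈ W, P.map (Y (a t)) = gaussianReal 0 γ)
    {D : Finset κ} (hD : Disjoint (W.image a) D) {h : ℕ → (D → ℝ) → ℝ} (hh : ∀ t, Measurable (h t))
    (K : ℝ) :
    P {ω | K ≤ ∑ t ∈ W, Real.logb 2 (densityRatio γ (σ t) (Y (a t) ω) (h t fun k => Y k ω))}
      ≤ ENNReal.ofReal (2 ^ (-K)) := by
  have := hY.isProbabilityMeasure
  set A : Ω → W → ℝ := fun ω t => Y (a t) ω with hA
  set B : Ω → D → ℝ := fun ω k => Y k ω with hB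
  have hAm : Measurable A := by fun_prop
  have hBm : Measurable B := by fun_prop
  have hAB : IndepFun A B P :=
    (hY.indepFun_finset _ _ hD hm).comp
      (φ := fun (z : W.image a → ℝ) (t : W) => z ⟨a t, Finset.mem_image_of_mem _ t.2⟩) (ψ := id)
      (by fun_prop) measurable_id
  have hAlaw : P.map A = Measure.pi fun _ : W => gaussianReal 0 γ := by
    have hinj : Function.Injective fun t : W => a t := fun s t hst =>
      Subtype.ext (ha s.2 t.2 hst)
    rw [hA, (hY.precomp hinj).map_fun_eq_pi_map fun t => (hm _).aemeasurable]
    congr 1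
    ext1 t
    exact hlaw t t.2
  have := Measure.isProbabilityMeasure_map (μ := P) hBm.aemeasurable
  have hr : ∀ t : W, Measurable fun z : (W → ℝ) × (D → ℝ) =>
      ENNReal.ofReal (densityRatio γ (σ t) (z.1 t) (h t z.2)) := by
    intro t
    have hy : Measurable fun z : (W → ℝ) × (D → ℝ) => h t z.2 := (hh t).comp measurable_snd
    unfold densityRatio
    fun_prop
  set R : (W → ℝ) × (D → ℝ) → ℝ≥0∞ := fun z =>
    ∏ t : W, ENNReal.ofReal (densityRatio γ (σ t) (z.1 t) (h t z.2)) with hR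
  have hRm : Measurable R := Finset.measurable_prod _ fun t _ => hr t
  -- Fubini with the codeword integrated first: for fixed `y` the product over the slots factorizes
  -- into integrals equal to one, so the law of `B` never enters.
  have hint : ∫⁻ ω, R (A ω, B ω) ∂P = 1 := by
    rw [← lintegral_map (f := R) hRm (hAm.prodMk hBm),
      (indepFun_iff_map_prod_eq_prod_map_map hAm.aemeasurable hBm.aemeasurable).1 hAB, hAlaw,
      lintegral_prod_symm' _ hRm]
    have : ∀ y : D → ℝ, ∫⁻ x, R (x, y) ∂(Measure.pi fun _ : W => gaussianReal 0 γ) = 1 := by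
      intro y
      have hmt : ∀ t : W, Measurable fun s =>
          ENNReal.ofReal (densityRatio γ (σ t) s (h t y)) := fun t => by
        unfold densityRatio; fun_prop
      simp only [hR]
      rw [lintegral_prod_eq_prod_lintegral_of_indepFun Finset.univ _
        (iIndepFun_pi (μ := fun _ : W => gaussianReal 0 γ)
          (X := fun (t : W) s => ENNReal.ofReal (densityRatio γ (σ t) s (h t y)))
          fun t => (hmt t).aemeasurable) fun t => (hmt t).comp (measurable_pi_apply t)]
      refine Finset.prod_eq_one fun t _ => ?_
      rw [(measurePreserving_eval (fun _ : W => gaussianReal 0 γ) t).lintegral_comp (hmt t),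
        lintegral_densityRatio hγ (hσ t)]
    simp [this]
  have hK : ENNReal.ofReal (2 ^ K) ≠ 0 := by simp; positivity
  -- Markov's inequality at level `2 ^ K`.
  have hmk := meas_ge_le_lintegral_div (μ := P) (f := fun ω => R (A ω, B ω))
    (hRm.comp (hAm.prodMk hBm)).aemeasurable hK ENNReal.ofReal_ne_top
  rw [hint] at hmk
  refine (measure_mono ?_).trans (hmk.trans_eq ?_)
  · intro ω hω
    simp only [Set.mem_ofPred_eq] at hω ⊢
    have hpos : ∀ t : W, 0 < densityRatio γ (σ t) (A ω t) (h t (B ω)) := fun t =>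
      densityRatio_pos (hσ t) _ _
    simp only [hR]
    rw [← ENNReal.ofReal_prod_of_nonneg fun t _ => (hpos t).le]
    refine ENNReal.ofReal_le_ofReal ?_
    rw [← Real.le_logb_iff_rpow_le one_lt_two (Finset.prod_pos fun t _ => hpos t),
      Real.logb_prod _ _ fun t _ => (hpos t).ne']
    rw [← Finset.sum_coe_sort W] at hω
    exact hω
  · rw [Real.rpow_neg (by norm_num), ENNReal.ofReal_inv_of_pos (by positivity), one_div]

end Coordinates

/-! ### Product measures -/

lemma iIndepFun_sumElim_prod {Ω Ω' ι κ : Type*} [MeasurableSpace Ω] [MeasurableSpace Ω']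
    {μ : Measure Ω} {ν : Measure Ω'} {f : ι → Ω → ℝ} {g : κ → Ω' → ℝ} (hf : iIndepFun f μ)
    (hg : iIndepFun g ν) :
    iIndepFun (fun (k : ι ⊕ κ) (ω : Ω × Ω') => Sum.elim (fun i => f i ω.1) (fun j => g j ω.2) k)
      (μ.prod ν) := by
  have := hf.isProbabilityMeasure
  have := hg.isProbabilityMeasure
  rw [iIndepFun_iff_measure_inter_preimage_eq_mul] at hf hg ⊢
  intro S s hs
  have hl : ∀ i, (fun ω : Ω × Ω' => f i ω.1) ⁻¹' s (.inl i)
      = (f i ⁻¹' s (.inl i)) ×ˢ Set.univ := fun i => by ext; simp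
  have hr : ∀ j, (fun ω : Ω × Ω' => g j ω.2) ⁻¹' s (.inr j)
      = Set.univ ×ˢ (g j ⁻¹' s (.inr j)) := fun j => by ext; simp
  have hset : (⋂ k ∈ S, (fun ω : Ω × Ω' => Sum.elim (fun i => f i ω.1) (fun j => g j ω.2) k) ⁻¹' s k)
      = (⋂ i ∈ S.toLeft, f i ⁻¹' s (.inl i)) ×ˢ (⋂ j ∈ S.toRight, g j ⁻¹' s (.inr j)) := by
    ext ω
    simp
  rw [hset, Measure.prod_prod, hf S.toLeft (sets := fun i => s (.inl i)) fun i hi => hs _ (Finset.mem_toLeft.1 hi),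
    hg S.toRight (sets := fun j => s (.inr j)) fun i hi => hs _ (Finset.mem_toRight.1 hi),
    Finset.prod_sum_eq_prod_toLeft_mul_prod_toRight]
  simp only [Sum.elim_inl, Sum.elim_inr, hl, hr, Measure.prod_prod, measure_univ, one_mul, mul_one]

lemma iIndepFun_comp_measurePreserving {Ω Ω' ι : Type*} [MeasurableSpace Ω] [MeasurableSpace Ω']
    {μ : Measure Ω} {ν : Measure Ω'} {β : ι → Type*} [∀ i, MeasurableSpace (β i)]
    {f : ∀ i, Ω' → β i} {φ : Ω → Ω'} (hφ : MeasurePreserving φ μ ν) (hf : iIndepFun f ν)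
    (hm : ∀ i, Measurable (f i)) : iIndepFun (fun i ω => f i (φ ω)) μ := by
  rw [iIndepFun_iff_measure_inter_preimage_eq_mul] at hf ⊢
  intro S s hs
  have h := hf S hs
  have hmi : ∀ i ∈ S, MeasurableSet (f i ⁻¹' s i) := fun i hi => hm i (hs i hi)
  rw [← hφ.measure_preimage (S.measurableSet_biInter hmi).nullMeasurableSet,
    Finset.prod_congr rfl fun i hi =>
      (hφ.measure_preimage (hmi i hi).nullMeasurableSet).symm] at h
  simp only [Set.preimage_iInter] at h
  exact h

/-- A Fubini bound for an event `E` that need not be measurable: `E` depends on the first coordinate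
only through the countably valued `T`, so over the good set it is covered by countably many
rectangles whose bases `T ⁻¹' {c}` are disjoint. -/
lemma measure_prod_le_of_slices {α β ι : Type*} [MeasurableSpace α] [MeasurableSpace β]
    [Countable ι] {μ : Measure α} [IsProbabilityMeasure μ] {ν : Measure β} [IsProbabilityMeasure ν] {T : α → ι}
    (hT : ∀ c, MeasurableSet (T ⁻¹' {c})) {E : Set (α × β)}
    (hE : ∀ a a' y, T a = T a' → (a, y) ∈ E → (a', y) ∈ E) {G : Set α} {b : ℝ≥0∞}
    (hG : ∀ a ∈ G, ν {y | (a, y) ∈ E} ≤ b) : μ.prod ν E ≤ μ Gᶜ + b := by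
  set F : ι → Set β := fun c => {y | ∃ a ∈ G, T a = c ∧ (a, y) ∈ E} with hF
  have hsub : E ⊆ Gᶜ ×ˢ Set.univ ∪ ⋃ c, (T ⁻¹' {c}) ×ˢ F c := by
    rintro ⟨a, y⟩ h
    by_cases ha : a ∈ G
    · exact Or.inr (Set.mem_iUnion.2 ⟨T a, rfl, a, ha, rfl, h⟩)
    · exact Or.inl ⟨ha, trivial⟩
  -- All slices of `E` over one value of `T` coincide, so the union `F c` lies in a single good
  -- slice.
  have hFb : ∀ c, ν (F c) ≤ b := by
    intro c
    by_cases hc : ∃ a ∈ G, T a = c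
    · obtain ⟨a, ha, rfl⟩ := hc
      refine (measure_mono ?_).trans (hG a ha)
      rintro y ⟨a', _, haa', hy⟩
      exact hE a' a y haa' hy
    · have : F c = ∅ := by
        ext y
        simp only [hF, Set.mem_ofPred_eq, Set.mem_empty_iff_false, iff_false]
        rintro ⟨a, ha, hac, _⟩
        exact hc ⟨a, ha, hac⟩
      simp [this]
  have h1 : μ.prod ν (⋃ c, (T ⁻¹' {c}) ×ˢ F c) ≤ b :=
    calc μ.prod ν (⋃ c, (T ⁻¹' {c}) ×ˢ F c) ≤ ∑' c, μ.prod ν ((T ⁻¹' {c}) ×ˢ F c) :=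
          measure_iUnion_le _
      _ = ∑' c, μ (T ⁻¹' {c}) * ν (F c) := by simp only [Measure.prod_prod]
      _ ≤ ∑' c, μ (T ⁻¹' {c}) * b := ENNReal.tsum_le_tsum fun c => mul_le_mul_right (hFb c) _
      _ = μ (⋃ c, T ⁻¹' {c}) * b := by
          rw [ENNReal.tsum_mul_right, measure_iUnion _ hT]
          intro c c' hcc
          exact Disjoint.preimage _ (by simpa using hcc)
      _ ≤ 1 * b := mul_le_mul_left prob_le_one _
      _ = b := one_mul b
  refine (measure_mono hsub).trans ((measure_union_le _ _).trans (add_le_add ?_ h1))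
  rw [Measure.prod_prod, measure_univ, mul_one]

/-! ### Independence of the symbols -/

namespace System

variable (S : System)

/-- The codebooks, preambles and noise sequences. -/
abbrev Symbols (n : ℕ) : Type :=
  ((i : Fin 2) → Fin (2 ^ S.bits n i) → Fin (S.len n i) → ℝ) ×
  (Fin 2 → Fin (S.pre n) → ℝ) ×
  (Fin 2 → ℕ → ℝ)

/-- The law of the packet arrivals. -/
def arrivalLaw : Measure (Fin 2 → ℕ → Bool) :=
  Measure.pi fun i => Measure.infinitePi fun _ : ℕ => bernoulliMeasure true false (S.q i)

/-- The law of codebooks, preambles and noise. -/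
def symbolLaw (n : ℕ) : Measure (S.Symbols n) :=
  (Measure.pi fun i => Measure.pi fun _ => Measure.pi fun _ => gaussianReal 0 (S.γ i)).prod
  ((Measure.pi fun i => Measure.pi fun _ => gaussianReal 0 (S.γ i)).prod
  (Measure.pi fun _ => Measure.infinitePi fun _ : ℕ => gaussianReal 0 1))

instance : IsProbabilityMeasure S.arrivalLaw := by unfold arrivalLaw; infer_instance

instance (n : ℕ) : IsProbabilityMeasure (S.symbolLaw n) := by unfold symbolLaw; infer_instance

/-- The index set of all Gaussian symbols: codebook, preamble and noise symbols. -/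
abbrev Coord (n : ℕ) : Type :=
  ((i : Fin 2) × (_ : Fin (2 ^ S.bits n i)) × Fin (S.len n i)) ⊕
    (((_ : Fin 2) × Fin (S.pre n)) ⊕ ((_ : Fin 2) × ℕ))

/-- The Gaussian symbols as random variables. -/
def coord (n : ℕ) (k : S.Coord n) (r : S.Symbols n) : ℝ :=
  Sum.elim (fun c => r.1 c.1 c.2.1 c.2.2)
    (fun c => Sum.elim (fun p => r.2.1 p.1 p.2) (fun p => r.2.2 p.1 p.2) c) k

/-- The variances of the Gaussian symbols. -/
def coordVar (n : ℕ) : S.Coord n → ℝ≥0 :=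
  Sum.elim (fun c => S.γ c.1) (Sum.elim (fun p => S.γ p.1) fun _ => 1)

lemma measurable_coord (n : ℕ) (k : S.Coord n) : Measurable (S.coord n k) := by
  rcases k with ⟨i, m, l⟩ | ⟨i, l⟩ | ⟨i, l⟩
  · change Measurable fun r : S.Symbols n => r.1 i m l
    fun_prop
  · change Measurable fun r : S.Symbols n => r.2.1 i l
    fun_prop
  · change Measurable fun r : S.Symbols n => r.2.2 i l
    fun_prop

/-- The index type mirrors the nesting of the measure: a binary product of measures gives a sum of
index types, and an iterated product a sigma type. -/
lemma iIndepFun_coord (n : ℕ) : iIndepFun (S.coord n) (S.symbolLaw n) := by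
  refine iIndepFun_sumElim_prod (f := fun (c : (i : Fin 2) × (_ : Fin (2 ^ S.bits n i)) ×
    Fin (S.len n i)) (r : (i : Fin 2) → Fin (2 ^ S.bits n i) → Fin (S.len n i) → ℝ) =>
      r c.1 c.2.1 c.2.2) ?_ (iIndepFun_sumElim_prod
      (f := fun (p : (_ : Fin 2) × Fin (S.pre n)) (r : Fin 2 → Fin (S.pre n) → ℝ) => r p.1 p.2)
      (g := fun (p : (_ : Fin 2) × ℕ) (r : Fin 2 → ℕ → ℝ) => r p.1 p.2) ?_ ?_)
  · refine iIndepFun_uncurry (X := fun i (p : (_ : Fin (2 ^ S.bits n i)) × Fin (S.len n i))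
      (r : (i : Fin 2) → Fin (2 ^ S.bits n i) → Fin (S.len n i) → ℝ) => r i p.1 p.2)
      (by fun_prop) ?_ fun i => ?_
    · exact iIndepFun_pi (X := fun i (z : Fin (2 ^ S.bits n i) → Fin (S.len n i) → ℝ)
        (p : (_ : Fin (2 ^ S.bits n i)) × Fin (S.len n i)) => z p.1 p.2)
        fun i => Measurable.aemeasurable (by fun_prop)
    · refine iIndepFun_comp_measurePreserving (measurePreserving_eval _ i)
        (f := fun (p : (_ : Fin (2 ^ S.bits n i)) × Fin (S.len n i))
          (z : Fin (2 ^ S.bits n i) → Fin (S.len n i) → ℝ) => z p.1 p.2) ?_ (by fun_prop)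
      refine iIndepFun_uncurry (X := fun m l (z : Fin (2 ^ S.bits n i) → Fin (S.len n i) → ℝ) =>
        z m l) (by fun_prop) ?_ fun m => ?_
      · exact iIndepFun_pi (X := fun _ (z : Fin (S.len n i) → ℝ) l => z l)
          fun _ => Measurable.aemeasurable (by fun_prop)
      · refine iIndepFun_comp_measurePreserving (measurePreserving_eval _ m)
          (f := fun l (z : Fin (S.len n i) → ℝ) => z l) ?_ (by fun_prop)
        exact iIndepFun_pi (X := fun _ (z : ℝ) => z) fun _ => aemeasurable_id
  · refine iIndepFun_uncurry (X := fun i l (z : Fin 2 → Fin (S.pre n) → ℝ) => z i l)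
      (by fun_prop) ?_ fun i => ?_
    · exact iIndepFun_pi (X := fun _ (z : Fin (S.pre n) → ℝ) l => z l)
        fun _ => Measurable.aemeasurable (by fun_prop)
    · refine iIndepFun_comp_measurePreserving (measurePreserving_eval _ i)
        (f := fun l (z : Fin (S.pre n) → ℝ) => z l) ?_ (by fun_prop)
      exact iIndepFun_pi (X := fun _ (z : ℝ) => z) fun _ => aemeasurable_id
  · refine iIndepFun_uncurry (X := fun i l (z : Fin 2 → ℕ → ℝ) => z i l)
      (by fun_prop) ?_ fun i => ?_
    · exact iIndepFun_pi (X := fun _ (z : ℕ → ℝ) l => z l)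
        fun _ => Measurable.aemeasurable (by fun_prop)
    · refine iIndepFun_comp_measurePreserving (measurePreserving_eval _ i)
        (f := fun l (z : ℕ → ℝ) => z l) ?_ (by fun_prop)
      exact iIndepFun_infinitePi (X := fun _ (z : ℝ) => z) fun _ => measurable_id

lemma map_coord (n : ℕ) (k : S.Coord n) :
    (S.symbolLaw n).map (S.coord n k) = gaussianReal 0 (S.coordVar n k) := by
  rcases k with ⟨i, m, l⟩ | ⟨i, l⟩ | ⟨i, l⟩
  · have h1 := measurePreserving_eval (fun _ : Fin (S.len n i) => gaussianReal 0 (S.γ i)) l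
    have h2 := measurePreserving_eval (fun _ : Fin (2 ^ S.bits n i) =>
      Measure.pi fun _ : Fin (S.len n i) => gaussianReal 0 (S.γ i)) m
    have h3 := measurePreserving_eval (fun i => Measure.pi fun _ : Fin (2 ^ S.bits n i) =>
      Measure.pi fun _ : Fin (S.len n i) => gaussianReal 0 (S.γ i)) i
    exact (h1.comp (h2.comp (h3.comp measurePreserving_fst))).map_eq
  · have h1 := measurePreserving_eval (fun _ : Fin (S.pre n) => gaussianReal 0 (S.γ i)) l
    have h2 := measurePreserving_eval (fun i =>
      Measure.pi fun _ : Fin (S.pre n) => gaussianReal 0 (S.γ i)) i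
    exact (h1.comp (h2.comp (measurePreserving_fst.comp measurePreserving_snd))).map_eq
  · have h1 := measurePreserving_eval_infinitePi (fun _ : ℕ => gaussianReal 0 1) l
    have h2 := measurePreserving_eval (fun _ : Fin 2 =>
      Measure.infinitePi fun _ : ℕ => gaussianReal 0 1) i
    exact (h1.comp (h2.comp (measurePreserving_snd.comp measurePreserving_snd))).map_eq

end System

/-! ### Events of probability tending to one -/

/-- The filter of the events, depending on a scaling parameter, whose probability tends to one. -/
def whp {β : Type*} [MeasurableSpace β] (P : Measure β) : Filter (ℕ × β) where
  sets := {H | Tendsto (fun n => P {B | (n, B) ∉ H}) atTop (𝓝 0)}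
  univ_sets := by simp
  sets_of_superset {H H'} hH hHH' := by
    refine tendsto_of_tendsto_of_tendsto_of_le_of_le tendsto_const_nhds hH (fun _ => zero_le)
      fun n => measure_mono fun B hB hBH => hB (hHH' hBH)
  inter_sets {H H'} hH hH' := by
    have h : Tendsto (fun n => P {B | (n, B) ∉ H} + P {B | (n, B) ∉ H'}) atTop (𝓝 0) := by
      simpa using Tendsto.add hH hH'
    refine tendsto_of_tendsto_of_tendsto_of_le_of_le tendsto_const_nhds h (fun _ => zero_le)
      fun n => (measure_mono fun B hB => ?_).trans (measure_union_le _ _)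
    simpa [Set.mem_inter_iff, ← not_and_or] using hB

/-- Transfers deterministic statements for large `n` into the filter. Convergence in probability
then becomes ordinary `Tendsto`, stable under sums, maxima and minima. -/
lemma tendsto_fst_whp {β : Type*} [MeasurableSpace β] (P : Measure β) :
    Tendsto Prod.fst (whp P) atTop := by
  intro s hs
  change Tendsto (fun n => P {B | n ∉ s}) atTop (𝓝 0)
  refine tendsto_const_nhds.congr' ?_
  filter_upwards [hs] with n hn
  simp [hn]

lemma natCast_sub_eq_max (a b : ℕ) : ((a - b : ℕ) : ℝ) = max ((a : ℝ) - b) 0 := by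
  rcases le_total b a with h | h
  · rw [Nat.cast_sub h, max_eq_left]
    have : (b : ℝ) ≤ a := by exact_mod_cast h
    linarith
  · rw [Nat.sub_eq_zero_of_le h, max_eq_right]
    · simp
    · have : (a : ℝ) ≤ b := by exact_mod_cast h
      linarith

lemma tendsto_floor_mul_div {x : ℝ} (hx : 0 ≤ x) :
    Tendsto (fun n : ℕ => (⌊(n : ℝ) * x⌋₊ : ℝ) / n) atTop (𝓝 x) := by
  have := (tendsto_nat_floor_mul_div_atTop hx).comp (tendsto_natCast_atTop_atTop (R := ℝ))
  simpa only [Function.comp_def, mul_comm] using this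

/-! ### Packet arrivals -/

namespace System

variable (S : System)

/-- The number of arrivals at the buffer of user `i` up to slot `t`. -/
def arrivalCount (n : ℕ) (i : Fin 2) (B : ℕ → Bool) (t : ℕ) : ℕ :=
  ((Finset.Icc (S.start n i) t).filter fun s => B s = true).card

lemma generated_eq (n : ℕ) (i : Fin 2) (B : ℕ → Bool) (t : ℕ) :
    S.generated n i B t = S.k i * min n (S.arrivalCount n i B t) := rfl

lemma generated_mono (n : ℕ) (i : Fin 2) (B : ℕ → Bool) : Monotone (S.generated n i B) := by
  intro s t hst
  rw [generated_eq, generated_eq]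
  refine Nat.mul_le_mul_left _ (min_le_min_left _ (Finset.card_le_card ?_))
  exact Finset.filter_subset_filter _ (Finset.Icc_subset_Icc_right hst)

/-- The variance of the indicator of an arrival. -/
def arrivalVar (i : Fin 2) : ℝ :=
  Var[fun b : Bool => if b = true then (1 : ℝ) else 0; bernoulliMeasure true false (S.q i)]

lemma measure_arrivalCount_sub_ge_le (n : ℕ) (i : Fin 2) (t : ℕ) {c : ℝ} (hc : 0 < c) :
    S.arrivalLaw {B | c ≤ |(S.arrivalCount n i (B i) t : ℝ)
        - ((t + 1 - S.start n i : ℕ) : ℝ) * S.q i|}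
      ≤ ENNReal.ofReal (((t + 1 - S.start n i : ℕ) : ℝ) * S.arrivalVar i / c ^ 2) := by
  have hmp : MeasurePreserving (fun B : Fin 2 → ℕ → Bool => B i) S.arrivalLaw
      (Measure.infinitePi fun _ : ℕ => bernoulliMeasure true false (S.q i)) :=
    measurePreserving_eval (fun i => Measure.infinitePi fun _ : ℕ =>
      bernoulliMeasure true false (S.q i)) i
  have hmps : ∀ s : ℕ, MeasurePreserving (fun B : Fin 2 → ℕ → Bool => B i s) S.arrivalLaw
      (bernoulliMeasure true false (S.q i)) := fun s =>
    (measurePreserving_eval_infinitePi _ s).comp hmp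
  have hφ : Measurable fun b : Bool => if b = true then (1 : ℝ) else 0 := measurable_of_finite _
  have hL : MemLp (fun b : Bool => if b = true then (1 : ℝ) else 0) 2
      (bernoulliMeasure true false (S.q i)) := MemLp.of_discrete
  have hind : iIndepFun (fun s (B : Fin 2 → ℕ → Bool) => if B i s = true then (1 : ℝ) else 0)
      S.arrivalLaw :=
    iIndepFun_comp_measurePreserving hmp
      (f := fun s (B : ℕ → Bool) => if B s = true then (1 : ℝ) else 0)
      (iIndepFun_infinitePi (X := fun _ (b : Bool) => if b = true then (1 : ℝ) else 0)
        fun _ => hφ) fun s => hφ.comp (measurable_pi_apply s)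
  have key := measure_abs_sum_sub_ge_le (P := S.arrivalLaw)
    (X := fun s (B : Fin 2 → ℕ → Bool) => if B i s = true then (1 : ℝ) else 0)
    (T := Finset.Icc (S.start n i) t) (m := S.q i) (V := S.arrivalVar i) (c := c)
    (fun s _ => hL.comp_measurePreserving (hmps s)) (fun s _ => ?_) (fun s _ => ?_)
    (fun s _ t _ hst => hind.indepFun hst) hc
  · simp only [arrivalCount, Finset.card_filter, Nat.cast_sum, Nat.cast_ite, Nat.cast_one,
      Nat.cast_zero]
    simpa only [Nat.card_Icc] using key
  · have := integral_map (hmps s).aemeasurable (f := fun b : Bool => if b = true then (1 : ℝ) else 0)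
      hφ.aestronglyMeasurable
    rw [(hmps s).map_eq, integral_bernoulliMeasure] at this
    simpa using this.symm
  · have := variance_map (Y := fun B : Fin 2 → ℕ → Bool => B i s) (μ := S.arrivalLaw)
      hφ.aemeasurable (hmps s).aemeasurable
    rw [(hmps s).map_eq] at this
    exact this.symm

/-- The weak law of large numbers at one fixed scaled time. The positive part appears because there
are no arrivals before the activation time. -/
lemma tendsto_arrivalCount_div {i : Fin 2} (hν : 0 < S.ν i) {x : ℝ} (hx : 0 ≤ x) :
    Tendsto (fun p : ℕ × (Fin 2 → ℕ → Bool) =>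
        (S.arrivalCount p.1 i (p.2 i) ⌊(p.1 : ℝ) * x⌋₊ : ℝ) / p.1)
      (whp S.arrivalLaw) (𝓝 (max (x - S.ν i) 0 * S.q i)) := by
  set m : ℕ → ℝ := fun n => ((⌊(n : ℝ) * x⌋₊ + 1 - S.start n i : ℕ) : ℝ) with hm
  have hm0 : Tendsto (fun n : ℕ => m n / n) atTop (𝓝 (max (x - S.ν i) 0)) := by
    have h1 := (((tendsto_floor_mul_div hx).add tendsto_one_div_atTop_nhds_zero_nat).sub
      (tendsto_floor_mul_div hν.le)).max (tendsto_const_nhds (x := (0 : ℝ)))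
    rw [add_zero] at h1
    refine h1.congr fun n => ?_
    rw [hm]
    simp only [natCast_sub_eq_max, start]
    rw [← max_div_div_right (Nat.cast_nonneg n)]
    push_cast
    ring_nf
  have hdev : Tendsto (fun p : ℕ × (Fin 2 → ℕ → Bool) =>
      (S.arrivalCount p.1 i (p.2 i) ⌊(p.1 : ℝ) * x⌋₊ : ℝ) / p.1 - m p.1 * S.q i / p.1)
      (whp S.arrivalLaw) (𝓝 0) := by
    rw [Metric.tendsto_nhds]
    intro ε hε
    change Tendsto (fun n => S.arrivalLaw {B | ¬ dist ((S.arrivalCount n i (B i)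
      ⌊(n : ℝ) * x⌋₊ : ℝ) / n - m n * S.q i / n) 0 < ε}) atTop (𝓝 0)
    have hb : Tendsto (fun n : ℕ => ENNReal.ofReal (m n / n * (S.arrivalVar i / ε ^ 2) *
        (1 / (n : ℝ)))) atTop (𝓝 0) := by
      have := ENNReal.tendsto_ofReal ((hm0.mul_const (S.arrivalVar i / ε ^ 2)).mul
        tendsto_one_div_atTop_nhds_zero_nat)
      simpa using this
    refine tendsto_of_tendsto_of_tendsto_of_le_of_le' tendsto_const_nhds hb
      (Eventually.of_forall fun _ => zero_le) ?_
    filter_upwards [eventually_gt_atTop 0] with n hn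
    have hn' : (0 : ℝ) < n := by exact_mod_cast hn
    refine (measure_mono ?_).trans ((S.measure_arrivalCount_sub_ge_le n i ⌊(n : ℝ) * x⌋₊
      (mul_pos hε hn')).trans_eq ?_)
    · intro B hB
      simp only [Set.mem_ofPred_eq, not_lt, dist_zero_right, Real.norm_eq_abs, ← sub_div,
        abs_div, abs_of_pos hn'] at hB ⊢
      rwa [le_div_iff₀ hn'] at hB
    · congr 1
      field_simp
      simp only [hm]
      ring
  have h2 : Tendsto (fun p : ℕ × (Fin 2 → ℕ → Bool) => m p.1 / p.1 * (S.q i : ℝ))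
      (whp S.arrivalLaw) (𝓝 (max (x - S.ν i) 0 * S.q i)) :=
    (hm0.mul_const _).comp (tendsto_fst_whp _)
  have := hdev.add h2
  rw [zero_add] at this
  refine this.congr fun p => ?_
  ring

/-! ### Transmission times -/

/-- A queue comparison: if enough bits for `j` codewords have been generated by slot `u j`, and the
slots `u j` leave room for a burst between them, then inductively no burst is scheduled later than
`u j`. The witness `u (j + 1)` also shows that the set under `sInf` is nonempty, without which the
infimum would be the default value `0`. -/
lemma burstTime_succ_le {n : ℕ} {i : Fin 2} {B : ℕ → Bool} (hb : 0 < S.bits n i) {u : ℕ → ℕ}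
    (h1 : ∀ j, 1 ≤ j → j ≤ S.N i → j * S.bits n i ≤ S.generated n i B (u j))
    (h0 : S.start n i ≤ u 1)
    (h2 : ∀ j, 1 ≤ j → j < S.N i → u j + S.pre n + S.len n i ≤ u (j + 1)) (j : ℕ)
    (hj : j < S.N i) :
    S.burstTime n i B (j + 1) ≤ u (j + 1) ∧
      (j + 1) * S.bits n i ≤ S.generated n i B (S.burstTime n i B (j + 1)) := by
  induction j with
  | zero =>
    have hmem : u 1 ∈ {t | S.start n i ≤ t ∧ S.bits n i ≤ S.backlog n i B 0 t} :=
      ⟨h0, by simpa [backlog] using h1 1 le_rfl hj⟩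
    have e : S.burstTime n i B (0 + 1)
        = sInf {t | S.start n i ≤ t ∧ S.bits n i ≤ S.backlog n i B 0 t} := by
      simp [burstTime]
    rw [e]
    exact ⟨Nat.sInf_le hmem, by simpa [backlog] using (Nat.sInf_mem ⟨_, hmem⟩).2⟩
  | succ j ih =>
    obtain ⟨ih1, -⟩ := ih (by omega)
    -- As `bits` is positive, the truncated subtraction in `backlog` does no harm.
    have hsub : ∀ t, S.bits n i ≤ S.backlog n i B (j + 1) t ↔
        (j + 1 + 1) * S.bits n i ≤ S.generated n i B t := fun t => by
      rw [backlog, add_mul (j + 1) 1, one_mul]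
      omega
    have hmem : u (j + 1 + 1) ∈ {t | S.burstTime n i B (j + 1) + S.pre n + S.len n i ≤ t ∧
        S.bits n i ≤ S.backlog n i B (j + 1) t} :=
      ⟨by have := h2 (j + 1) (by omega) hj; omega, (hsub _).2 (h1 _ (by omega) (by omega))⟩
    have e : S.burstTime n i B (j + 1 + 1)
        = sInf {t | S.burstTime n i B (j + 1) + S.pre n + S.len n i ≤ t ∧
            S.bits n i ≤ S.backlog n i B (j + 1) t} := by
      rw [burstTime]; simp
    rw [e]
    exact ⟨Nat.sInf_le hmem, (hsub _).1 (Nat.sInf_mem ⟨_, hmem⟩).2⟩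

/-- The scaled position of the `j`-th burst of user `i`. -/
def pos (i : Fin 2) (j : ℕ) : ℝ := S.ν i + j * S.μ i

lemma tendsto_bits_div (i : Fin 2) :
    Tendsto (fun n : ℕ => (S.bits n i : ℝ) / n) atTop (𝓝 (S.η i)) :=
  tendsto_floor_mul_div (div_nonneg (Nat.cast_nonneg _) (Nat.cast_nonneg _))

lemma tendsto_len_div {i : Fin 2} (hθ : 0 < S.θ i) :
    Tendsto (fun n : ℕ => (S.len n i : ℝ) / n) atTop (𝓝 (S.θ i)) :=
  tendsto_floor_mul_div hθ.le

lemma μ_mul_q {i : Fin 2} (hk : 0 < S.k i) (hN : 0 < S.N i) (hq : 0 < (S.q i : ℝ)) :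
    S.μ i * S.q i = 1 / S.N i := by
  have : (0 : ℝ) < S.k i := by exact_mod_cast hk
  have : (0 : ℝ) < S.N i := by exact_mod_cast hN
  rw [μ, η, rate]
  field_simp

lemma μ_pos {i : Fin 2} (hk : 0 < S.k i) (hN : 0 < S.N i) (hq : 0 < (S.q i : ℝ)) :
    0 < S.μ i := by
  have : (0 : ℝ) < S.k i := by exact_mod_cast hk
  have : (0 : ℝ) < S.N i := by exact_mod_cast hN
  rw [μ, η, rate]
  positivity

/-- Because `μ * q = 1 / N`, the expected arrivals reach `j n / N` packets, worth about `j n η`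
bits, at scaled time `ν + j μ`. Since `θ < μ`, the previous burst is over by then. The arrivals are
compared with this threshold at times `δ` after and `δ` before. -/
lemma tendsto_burstTime_div
    (hpre : Tendsto (fun n : ℕ => (S.pre n : ℝ) / (n : ℝ)) atTop (𝓝 0)) {i : Fin 2}
    (hk : 0 < S.k i) (hN : 0 < S.N i) (hq : 0 < (S.q i : ℝ)) (hθ : 0 < S.θ i) (hν : 0 < S.ν i)
    (hμ : 1 < S.N i → S.θ i < S.μ i) {j : ℕ} (hj1 : 1 ≤ j) (hj : j ≤ S.N i) :
    Tendsto (fun p : ℕ × (Fin 2 → ℕ → Bool) => (S.burstTime p.1 i (p.2 i) j : ℝ) / p.1)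
      (whp S.arrivalLaw) (𝓝 (S.pos i j)) := by
  have hk' : (0 : ℝ) < S.k i := by exact_mod_cast hk
  have hN' : (0 : ℝ) < S.N i := by exact_mod_cast hN
  have hμ0 := S.μ_pos hk hN hq
  have hμq := S.μ_mul_q hk hN hq
  have hfst := tendsto_fst_whp S.arrivalLaw
  rw [Metric.tendsto_nhds]
  intro ε hε
  set δ := ε / 2 with hδ
  have hδ0 : 0 < δ := by positivity
  set u : ℕ → ℕ → ℕ := fun n j => ⌊(n : ℝ) * (S.pos i j + δ)⌋₊ with hu
  have hpos0 : ∀ j, 0 ≤ S.pos i j := fun j => by rw [pos]; positivity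
  have hlim : ∀ j, Tendsto (fun n : ℕ => (u n j : ℝ) / n) atTop (𝓝 (S.pos i j + δ)) := fun j =>
    tendsto_floor_mul_div (by have := hpos0 j; positivity)
  have hupper : ∀ᶠ p in whp S.arrivalLaw, ∀ j ∈ Finset.Icc 1 (S.N i),
      j * S.bits p.1 i ≤ S.generated p.1 i (p.2 i) (u p.1 j) := by
    rw [Filter.eventually_all_finset]
    intro j hj
    have hjN : (j : ℝ) ≤ S.N i := by exact_mod_cast (Finset.mem_Icc.1 hj).2
    have hK := S.tendsto_arrivalCount_div hν (x := S.pos i j + δ) (by have := hpos0 j; positivity)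
    have hgt : (j : ℝ) / S.N i < max (S.pos i j + δ - S.ν i) 0 * S.q i := by
      rw [max_eq_left (by rw [pos]; ring_nf; positivity), pos]
      calc (j : ℝ) / S.N i = j * (S.μ i * S.q i) := by rw [hμq]; ring
        _ < j * (S.μ i * S.q i) + δ * S.q i := by linarith [mul_pos hδ0 hq]
        _ = _ := by ring
    filter_upwards [hK.eventually_const_lt hgt, hfst.eventually_gt_atTop 0] with p hp hn
    have hn' : (0 : ℝ) < p.1 := by exact_mod_cast hn
    -- The source stops after `n` packets, but `j ≤ N` keeps the required number `n j / N` below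
    -- this cap.
    have hmin : (p.1 : ℝ) * (j / S.N i) ≤ min (p.1 : ℝ) (S.arrivalCount p.1 i (p.2 i) (u p.1 j)) := by
      refine le_min ?_ ?_
      · exact mul_le_of_le_one_right hn'.le ((div_le_one hN').2 hjN)
      · rw [lt_div_iff₀ hn'] at hp
        rw [mul_comm]
        exact hp.le
    have hfl : (S.bits p.1 i : ℝ) ≤ p.1 * S.η i := Nat.floor_le (by rw [η]; positivity)
    rw [generated_eq]
    have : (j : ℝ) * S.bits p.1 i ≤
        S.k i * min (p.1 : ℝ) (S.arrivalCount p.1 i (p.2 i) (u p.1 j)) := by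
      calc (j : ℝ) * S.bits p.1 i ≤ j * (p.1 * S.η i) := by gcongr
        _ = S.k i * (p.1 * (j / S.N i)) := by rw [η]; ring
        _ ≤ _ := by gcongr
    exact_mod_cast this
  have hspace : ∀ᶠ n in atTop, ∀ j ∈ Finset.Ico 1 (S.N i),
      u n j + S.pre n + S.len n i ≤ u n (j + 1) := by
    rw [Filter.eventually_all_finset]
    intro j hj
    have hlt := hμ (by have := Finset.mem_Ico.1 hj; omega)
    have h1 := ((hlim j).add hpre).add (S.tendsto_len_div hθ)
    filter_upwards [h1.eventually_lt (hlim (j + 1)) (by simp only [pos]; push_cast; linarith),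
      eventually_gt_atTop 0] with n hn hn0
    have hn' : (0 : ℝ) < n := by exact_mod_cast hn0
    rw [← add_div, ← add_div, div_lt_div_iff_of_pos_right hn'] at hn
    exact_mod_cast hn.le
  have hstart : ∀ᶠ n in atTop, S.start n i ≤ u n 1 := by
    refine Eventually.of_forall fun n => Nat.floor_le_floor ?_
    have : S.ν i ≤ S.pos i 1 + δ := by rw [pos]; push_cast; linarith
    gcongr
  have hbits : ∀ᶠ n in atTop, 0 < S.bits n i := by
    filter_upwards [(S.tendsto_bits_div i).eventually_const_lt
      (show (0 : ℝ) < S.η i by rw [η]; positivity)] with n hn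
    rcases Nat.eq_zero_or_pos (S.bits n i) with h | h
    · simp [h] at hn
    · exact h
  -- The maximum with `0` is there because slots are natural numbers; `pos - δ` may be negative.
  set y := max 0 (S.pos i j - δ) with hy
  have hlower : ∀ᶠ p in whp S.arrivalLaw,
      S.generated p.1 i (p.2 i) ⌊(p.1 : ℝ) * y⌋₊ < j * S.bits p.1 i := by
    have hK := (S.tendsto_arrivalCount_div hν (x := y) (le_max_left _ _)).const_mul (S.k i : ℝ)
    have hb := ((S.tendsto_bits_div i).const_mul (j : ℝ)).comp hfst
    have hj0 : (0 : ℝ) < j := by exact_mod_cast hj1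
    have hlt : (S.k i : ℝ) * (max (y - S.ν i) 0 * S.q i) < j * S.η i := by
      have hjη : (j : ℝ) * S.η i = S.k i * (j * S.μ i * S.q i) := by
        rw [mul_assoc, hμq, η]; ring
      rw [hjη]
      gcongr
      refine max_lt ?_ (by positivity)
      rw [hy, sub_lt_iff_lt_add]
      refine max_lt (by positivity) ?_
      rw [pos]
      linarith
    filter_upwards [hK.eventually_lt hb hlt, hfst.eventually_gt_atTop 0] with p hp hn
    have hn' : (0 : ℝ) < p.1 := by exact_mod_cast hn
    simp only [Function.comp_apply, ← mul_div_assoc] at hp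
    rw [div_lt_div_iff_of_pos_right hn'] at hp
    have hp' : S.k i * S.arrivalCount p.1 i (p.2 i) ⌊(p.1 : ℝ) * y⌋₊ < j * S.bits p.1 i := by
      exact_mod_cast hp
    rw [generated_eq]
    exact (Nat.mul_le_mul_left _ (min_le_right _ _)).trans_lt hp'
  filter_upwards [hupper, hlower, hfst.eventually hspace, hfst.eventually hstart,
    hfst.eventually hbits, hfst.eventually_gt_atTop 0] with p hp1 hp2 hp3 hp4 hp5 hn
  have hn' : (0 : ℝ) < p.1 := by exact_mod_cast hn
  obtain ⟨j, rfl⟩ : ∃ j', j = j' + 1 := ⟨j - 1, by omega⟩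
  obtain ⟨h1, h2⟩ := S.burstTime_succ_le hp5 (u := u p.1)
    (fun j h h' => hp1 j (Finset.mem_Icc.2 ⟨h, h'⟩)) hp4
    (fun j h h' => hp3 j (Finset.mem_Ico.2 ⟨h, h'⟩)) j hj
  -- At the burst time `(j + 1) * bits` bits have been generated, at slot `⌊n y⌋` fewer, and
  -- `generated` is monotone.
  have h3 : ⌊(p.1 : ℝ) * y⌋₊ < S.burstTime p.1 i (p.2 i) (j + 1) := by
    by_contra hcon
    exact absurd (h2.trans (S.generated_mono p.1 i (p.2 i) (not_lt.1 hcon))) (not_le.2 hp2)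
  have h4 : (p.1 : ℝ) * y < S.burstTime p.1 i (p.2 i) (j + 1) := Nat.lt_of_floor_lt h3
  have h5 : (S.burstTime p.1 i (p.2 i) (j + 1) : ℝ) ≤ p.1 * (S.pos i (j + 1) + δ) := by
    have : (S.burstTime p.1 i (p.2 i) (j + 1) : ℝ) ≤ u p.1 (j + 1) := by exact_mod_cast h1
    exact this.trans (Nat.floor_le (by have := hpos0 (j + 1); positivity))
  rw [Real.dist_eq, abs_lt]
  constructor
  · have : y < (S.burstTime p.1 i (p.2 i) (j + 1) : ℝ) / p.1 := by
      rw [lt_div_iff₀ hn']; linarith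
    have := le_max_right 0 (S.pos i (j + 1) - δ)
    linarith
  · have : (S.burstTime p.1 i (p.2 i) (j + 1) : ℝ) / p.1 ≤ S.pos i (j + 1) + δ := by
      rw [div_le_iff₀ hn']; linarith
    linarith

/-! ### Measurability of the transmission times -/

/-- The infimum is `v` if `v` is the first time at which `p` holds, or if `p` never holds and `v` is
the default `0`. -/
lemma _root_.GICSDA.measurable_sInf_setOf {α : Type*} [MeasurableSpace α] {p : α → ℕ → Prop}
    (hp : ∀ t, MeasurableSet {a | p a t}) : Measurable fun a => sInf {t | p a t} := by
  refine measurable_to_countable' fun v => ?_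
  have hA : MeasurableSet ({a | p a v} ∩ ⋂ t ∈ Finset.range v, {a | p a t}ᶜ) :=
    (hp v).inter (Finset.measurableSet_biInter _ fun t _ => (hp t).compl)
  have hB : MeasurableSet (⋂ t, {a | p a t}ᶜ) := MeasurableSet.iInter fun t => (hp t).compl
  have : (fun a => sInf {t | p a t}) ⁻¹' {v}
      = ({a | p a v} ∩ ⋂ t ∈ Finset.range v, {a | p a t}ᶜ) ∪
        ((⋂ t, {a | p a t}ᶜ) ∩ {_a | v = 0}) := by
    ext a
    simp only [Set.mem_preimage, Set.mem_singleton_iff, Set.mem_union, Set.mem_inter_iff,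
      Set.mem_ofPred_eq, Set.mem_iInter, Set.mem_compl_iff, Finset.mem_range]
    constructor
    · rintro rfl
      by_cases h : {t | p a t}.Nonempty
      · exact Or.inl ⟨Nat.sInf_mem h, fun t ht => Nat.notMem_of_lt_sInf ht⟩
      · rw [Set.not_nonempty_iff_eq_empty] at h
        exact Or.inr ⟨fun t ht => by simpa [h] using (show t ∈ {t | p a t} from ht), by simp [h]⟩
    · rintro (⟨h1, h2⟩ | ⟨h1, rfl⟩)
      · refine le_antisymm (Nat.sInf_le h1) ?_
        by_contra hlt
        exact h2 _ (not_le.1 hlt) (Nat.sInf_mem ⟨v, h1⟩)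
      · have : {t | p a t} = ∅ := by ext t; simpa using h1 t
        simp [this]
  rw [this]
  exact hA.union (hB.inter (MeasurableSet.const _))

lemma measurable_generated (n : ℕ) (i : Fin 2) (t : ℕ) :
    Measurable fun B : ℕ → Bool => S.generated n i B t := by
  simp only [generated, Finset.card_filter]
  refine measurable_const.mul (measurable_const.min (Finset.measurable_sum _ fun s _ => ?_))
  exact (measurable_of_finite fun b : Bool => if b = true then 1 else 0).comp
    (measurable_pi_apply s)

lemma measurable_burstTime (n : ℕ) (i : Fin 2) (j : ℕ) :
    Measurable fun B : ℕ → Bool => S.burstTime n i B j := by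
  induction j with
  | zero => simp only [burstTime]; exact measurable_const
  | succ j ih =>
    simp only [burstTime]
    refine measurable_sInf_setOf fun t => ?_
    refine MeasurableSet.inter (s₁ := {B | (if j = 0 then S.start n i
      else S.burstTime n i B j + S.pre n + S.len n i) ≤ t})
      (s₂ := {B | S.bits n i ≤ S.backlog n i B j t}) ?_ ?_
    · split_ifs
      · exact MeasurableSet.const _
      · exact measurableSet_le ((ih.add_const _).add_const _) measurable_const
    · exact measurableSet_le measurable_const ((S.measurable_generated n i t).sub_const _)

end System

/-! ### Segments of the window -/

lemma tendsto_card_Ioc_div {β : Type*} {l : Filter (ℕ × β)} {P Q : ℕ × β → ℕ} {p q : ℝ}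
    (hP : Tendsto (fun x => (P x : ℝ) / x.1) l (𝓝 p))
    (hQ : Tendsto (fun x => (Q x : ℝ) / x.1) l (𝓝 q)) :
    Tendsto (fun x => ((Finset.Ioc (P x) (Q x)).card : ℝ) / x.1) l (𝓝 (max (q - p) 0)) := by
  refine ((hQ.sub hP).max tendsto_const_nhds).congr fun x => ?_
  rw [Nat.card_Ioc, natCast_sub_eq_max, ← max_div_div_right (Nat.cast_nonneg _), sub_div, zero_div]

/-- Distinct limits of the ends rule out short nonempty intervals, on which Chebyshev's inequality
would say nothing. -/
lemma exists_eventually_Ioc_empty_or_le_card {β : Type*} {l : Filter (ℕ × β)}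
    (hl : Tendsto Prod.fst l atTop) {P Q : ℕ × β → ℕ} {p q : ℝ}
    (hP : Tendsto (fun x => (P x : ℝ) / x.1) l (𝓝 p))
    (hQ : Tendsto (fun x => (Q x : ℝ) / x.1) l (𝓝 q)) (hpq : p ≠ q) :
    ∃ κ : ℝ, 0 < κ ∧ ∀ᶠ x in l, (Finset.Ioc (P x) (Q x)).Nonempty →
      κ * x.1 ≤ ((Finset.Ioc (P x) (Q x)).card : ℝ) := by
  rcases hpq.lt_or_gt with h | h
  · refine ⟨(q - p) / 2, by linarith, ?_⟩
    filter_upwards [(tendsto_card_Ioc_div hP hQ).eventually_const_lt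
      (u := (q - p) / 2) (lt_max_of_lt_left (by linarith)), hl.eventually_gt_atTop 0] with x hx hn _
    have hn' : (0 : ℝ) < x.1 := by exact_mod_cast hn
    exact ((lt_div_iff₀ hn').1 hx).le
  · refine ⟨1, one_pos, ?_⟩
    filter_upwards [hQ.eventually_lt hP h, hl.eventually_gt_atTop 0] with x hx hn hne
    have hn' : (0 : ℝ) < x.1 := by exact_mod_cast hn
    rw [div_lt_div_iff_of_pos_right hn'] at hx
    have hx' : Q x < P x := by exact_mod_cast hx
    obtain ⟨t, ht⟩ := hne
    rw [Finset.mem_Ioc] at ht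
    omega

lemma exists_pos_forall_eventually_of_antitone {α : Type*} {l : Filter α} (s : Finset ℕ)
    {p : ℕ → ℝ → α → Prop} (hp : ∀ j ∈ s, ∀ κ κ' x, κ' ≤ κ → p j κ x → p j κ' x)
    (h : ∀ j ∈ s, ∃ κ : ℝ, 0 < κ ∧ ∀ᶠ x in l, p j κ x) :
    ∃ κ : ℝ, 0 < κ ∧ ∀ᶠ x in l, ∀ j ∈ s, p j κ x := by
  induction s using Finset.induction_on with
  | empty => exact ⟨1, one_pos, by simp⟩
  | insert a s has ih =>
    obtain ⟨κ, hκ, h1⟩ := ih (fun j hj => hp j (Finset.mem_insert_of_mem hj))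
      fun j hj => h j (Finset.mem_insert_of_mem hj)
    obtain ⟨κ', hκ', h2⟩ := h a (Finset.mem_insert_self _ _)
    refine ⟨min κ κ', lt_min hκ hκ', ?_⟩
    filter_upwards [h1, h2] with x hx1 hx2 j hj
    rcases Finset.mem_insert.1 hj with rfl | hj'
    · exact hp _ hj _ _ _ (min_le_right _ _) hx2
    · exact hp _ hj _ _ _ (min_le_left _ _) (hx1 j hj')

namespace System

variable (S : System)

/-- The slot after which the `j`-th burst of user `i` is sent, given the arrivals. -/
def time (n : ℕ) (B : Fin 2 → ℕ → Bool) (i : Fin 2) (j : ℕ) : ℕ := S.burstTime n i (B i) j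

/-- The bursts of user `i` do not overlap. -/
def Ordered (n : ℕ) (B : Fin 2 → ℕ → Bool) (i : Fin 2) : Prop :=
  ∀ j₁ j₂, 1 ≤ j₁ → j₁ < j₂ → j₂ ≤ S.N i →
    S.time n B i j₁ + S.pre n + S.len n i ≤ S.time n B i j₂

/-- The slots of the `j`-th codeword of user `i`, given the arrivals. -/
def codeSlots (n : ℕ) (B : Fin 2 → ℕ → Bool) (i : Fin 2) (j : ℕ) : Finset ℕ :=
  Finset.Ioc (S.time n B i j + S.pre n) (S.time n B i j + S.pre n + S.len n i)

/-- The overlap of the `j`-th codeword with the `j'`-th burst of the other user. -/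
def overlap (n : ℕ) (B : Fin 2 → ℕ → Bool) (i : Fin 2) (j j' : ℕ) : Finset ℕ :=
  Finset.Ioc (max (S.time n B i j + S.pre n) (S.time n B (other i) j'))
    (min (S.time n B i j + S.pre n + S.len n i)
      (S.time n B (other i) j' + S.pre n + S.len n (other i)))

/-- The part of the `j`-th codeword between two bursts of the other user. -/
def gap (n : ℕ) (B : Fin 2 → ℕ → Bool) (i : Fin 2) (j j' : ℕ) : Finset ℕ :=
  Finset.Ioc
    (if j' = 0 then S.time n B i j + S.pre n else
      max (S.time n B i j + S.pre n) (S.time n B (other i) j' + S.pre n + S.len n (other i)))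
    (if j' = S.N (other i) then S.time n B i j + S.pre n + S.len n i else
      min (S.time n B i j + S.pre n + S.len n i) (S.time n B (other i) (j' + 1)))

lemma interferedSegment_eq (n : ℕ) (B : Fin 2 → ℕ → Bool) (r : S.Symbols n) (i : Fin 2)
    (j j' : ℕ) : S.interferedSegment n (B, r) i j j' = S.overlap n B i j j' := by
  ext t
  rw [interferedSegment, window, Finset.mem_filter, Finset.mem_Icc]
  simp only [overlap, Finset.mem_Ioc, τ, time, max_lt_iff, le_min_iff]
  omega

lemma clearSegment_eq (n : ℕ) (B : Fin 2 → ℕ → Bool) (r : S.Symbols n) (i : Fin 2)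
    (j j' : ℕ) : S.clearSegment n (B, r) i j j' = S.gap n B i j j' := by
  ext t
  rw [clearSegment, window, Finset.mem_filter, Finset.mem_Icc]
  simp only [gap, Finset.mem_Ioc, τ, time]
  split_ifs <;> simp only [max_lt_iff, le_min_iff, *] <;> simp <;> omega

lemma overlap_subset (n : ℕ) (B : Fin 2 → ℕ → Bool) (i : Fin 2) (j j' : ℕ) :
    S.overlap n B i j j' ⊆ S.codeSlots n B i j :=
  Finset.Ioc_subset_Ioc (le_max_left _ _) (min_le_left _ _)

lemma gap_subset (n : ℕ) (B : Fin 2 → ℕ → Bool) (i : Fin 2) (j j' : ℕ) :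
    S.gap n B i j j' ⊆ S.codeSlots n B i j := by
  refine Finset.Ioc_subset_Ioc ?_ ?_
  · split_ifs
    exacts [le_rfl, le_max_left _ _]
  · split_ifs
    exacts [le_rfl, min_le_left _ _]

/-! ### Overlaps and gaps partition the slots of a codeword -/

section Partition

variable {S} {n : ℕ} {B : Fin 2 → ℕ → Bool} {i : Fin 2} {j : ℕ}

lemma disjoint_overlap (h : S.Ordered n B (other i)) {j₁ j₂ : ℕ}
    (h₁ : j₁ ∈ Finset.Icc 1 (S.N (other i))) (h₂ : j₂ ∈ Finset.Icc 1 (S.N (other i)))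
    (hne : j₁ ≠ j₂) : Disjoint (S.overlap n B i j j₁) (S.overlap n B i j j₂) := by
  rw [Finset.mem_Icc] at h₁ h₂
  rw [Finset.disjoint_left]
  intro t ht ht'
  simp only [overlap, Finset.mem_Ioc, max_lt_iff, le_min_iff] at ht ht'
  rcases hne.lt_or_gt with hlt | hlt
  · have := h j₁ j₂ h₁.1 hlt h₂.2; omega
  · have := h j₂ j₁ h₂.1 hlt h₁.2; omega

lemma lt_of_mem_gap {j' t : ℕ} (h0 : j' ≠ 0) (ht : t ∈ S.gap n B i j j') :
    S.time n B (other i) j' + S.pre n + S.len n (other i) < t := by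
  simp only [gap, if_neg h0, Finset.mem_Ioc, max_lt_iff] at ht
  exact ht.1.2

lemma le_of_mem_gap {j' t : ℕ} (h0 : j' ≠ S.N (other i)) (ht : t ∈ S.gap n B i j j') :
    t ≤ S.time n B (other i) (j' + 1) := by
  simp only [gap, if_neg h0, Finset.mem_Ioc, le_min_iff] at ht
  exact ht.2.2

lemma Ordered.time_le (h : S.Ordered n B i) {j₁ j₂ : ℕ} (h₁ : 1 ≤ j₁) (h₁₂ : j₁ ≤ j₂)
    (h₂ : j₂ ≤ S.N i) : S.time n B i j₁ ≤ S.time n B i j₂ := by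
  rcases h₁₂.eq_or_lt with rfl | hlt
  · exact le_rfl
  · have := h j₁ j₂ h₁ hlt h₂; omega

lemma disjoint_gap (h : S.Ordered n B (other i)) {j₁ j₂ : ℕ}
    (h₁ : j₁ ∈ Finset.range (S.N (other i) + 1)) (h₂ : j₂ ∈ Finset.range (S.N (other i) + 1))
    (hne : j₁ ≠ j₂) : Disjoint (S.gap n B i j j₁) (S.gap n B i j j₂) := by
  rw [Finset.mem_range] at h₁ h₂
  rw [Finset.disjoint_left]
  intro t ht ht'
  wlog hlt : j₁ < j₂ generalizing j₁ j₂
  · exact this h₂ h₁ hne.symm ht' ht (by omega)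
  have e1 := le_of_mem_gap (by omega) ht
  have e2 := lt_of_mem_gap (by omega) ht'
  have e3 := h.time_le (j₁ := j₁ + 1) (j₂ := j₂) (by omega) (by omega) (by omega)
  omega

lemma disjoint_overlap_gap (h : S.Ordered n B (other i)) {j₁ j₂ : ℕ}
    (h₁ : j₁ ∈ Finset.Icc 1 (S.N (other i))) (h₂ : j₂ ∈ Finset.range (S.N (other i) + 1)) :
    Disjoint (S.overlap n B i j j₁) (S.gap n B i j j₂) := by
  rw [Finset.mem_Icc] at h₁
  rw [Finset.mem_range] at h₂
  rw [Finset.disjoint_left]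
  intro t ht ht'
  simp only [overlap, Finset.mem_Ioc, max_lt_iff, le_min_iff] at ht
  rcases le_or_gt j₁ j₂ with hle | hlt
  · have e2 := lt_of_mem_gap (by omega) ht'
    have := h.time_le h₁.1 hle (by omega)
    omega
  · have e1 := le_of_mem_gap (by omega) ht'
    have := h.time_le (j₁ := j₂ + 1) (j₂ := j₁) (by omega) (by omega) (by omega)
    omega

/-- Take the last index `m` whose burst begins before slot `t`, with `m = 0` if there is none: `t`
lies in that burst or in the gap that follows it. -/
lemma exists_mem_overlap_or_mem_gap {t : ℕ} (ht : t ∈ S.codeSlots n B i j) :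
    (∃ j' ∈ Finset.Icc 1 (S.N (other i)), t ∈ S.overlap n B i j j') ∨
      ∃ j' ∈ Finset.range (S.N (other i) + 1), t ∈ S.gap n B i j j' := by
  set P : ℕ → Prop := fun j' => j' = 0 ∨ S.time n B (other i) j' < t
  classical
  set m := Nat.findGreatest P (S.N (other i)) with hm
  have hPm : P m := Nat.findGreatest_spec (P := P) (Nat.zero_le _) (Or.inl rfl)
  have hmN : m ≤ S.N (other i) := Nat.findGreatest_le _
  have hnext : m ≠ S.N (other i) → t ≤ S.time n B (other i) (m + 1) := by
    intro hne
    have := Nat.findGreatest_is_greatest (P := P) (n := S.N (other i)) (k := m + 1)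
      (by omega) (by omega)
    simpa [P] using this
  simp only [codeSlots, Finset.mem_Ioc] at ht
  by_cases hcov : m ≠ 0 ∧ t ≤ S.time n B (other i) m + S.pre n + S.len n (other i)
  · refine Or.inl ⟨m, Finset.mem_Icc.2 ⟨by omega, hmN⟩, ?_⟩
    have : S.time n B (other i) m < t := hPm.resolve_left hcov.1
    simp only [overlap, Finset.mem_Ioc, max_lt_iff, le_min_iff]
    exact ⟨⟨ht.1, this⟩, ht.2, hcov.2⟩
  · refine Or.inr ⟨m, Finset.mem_range.2 (by omega), ?_⟩
    simp only [gap, Finset.mem_Ioc]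
    constructor
    · split_ifs with h0
      · exact ht.1
      · exact max_lt ht.1 (by by_contra hc; exact hcov ⟨h0, not_lt.1 hc⟩)
    · split_ifs with h0
      · exact ht.2
      · exact le_min ht.2 (hnext h0)

lemma sum_codeSlots (h : S.Ordered n B (other i)) (f : ℕ → ℝ) :
    ∑ t ∈ S.codeSlots n B i j, f t =
      ∑ j' ∈ Finset.Icc 1 (S.N (other i)), ∑ t ∈ S.overlap n B i j j', f t +
      ∑ j' ∈ Finset.range (S.N (other i) + 1), ∑ t ∈ S.gap n B i j j', f t := by
  have hU : S.codeSlots n B i j =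
      (Finset.Icc 1 (S.N (other i))).biUnion (S.overlap n B i j) ∪
      (Finset.range (S.N (other i) + 1)).biUnion (S.gap n B i j) := by
    ext t
    simp only [Finset.mem_union, Finset.mem_biUnion]
    refine ⟨exists_mem_overlap_or_mem_gap, ?_⟩
    rintro (⟨j', _, ht⟩ | ⟨j', _, ht⟩)
    exacts [S.overlap_subset _ _ _ _ _ ht, S.gap_subset _ _ _ _ _ ht]
  rw [hU, Finset.sum_union, Finset.sum_biUnion, Finset.sum_biUnion]
  · exact fun j₁ h₁ j₂ h₂ hne => disjoint_gap h h₁ h₂ hne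
  · exact fun j₁ h₁ j₂ h₂ hne => disjoint_overlap h h₁ h₂ hne
  · rw [Finset.disjoint_biUnion_left]
    intro j₁ h₁
    rw [Finset.disjoint_biUnion_right]
    exact fun j₂ h₂ => disjoint_overlap_gap h h₁ h₂

lemma len_eq_sum_card (h : S.Ordered n B (other i)) :
    (S.len n i : ℝ) = ∑ j' ∈ Finset.Icc 1 (S.N (other i)), ((S.overlap n B i j j').card : ℝ) +
      ∑ j' ∈ Finset.range (S.N (other i) + 1), ((S.gap n B i j j').card : ℝ) := by
  have := sum_codeSlots (j := j) h fun _ => 1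
  simpa [codeSlots] using this

end Partition

/-! ### Asymptotics of the segments -/

/-- The standing assumptions on the parameters. -/
structure Regular : Prop where
  k_pos : ∀ i, 0 < S.k i
  N_pos : ∀ i, 0 < S.N i
  q_pos : ∀ i, 0 < (S.q i : ℝ)
  θ_pos : ∀ i, 0 < S.θ i
  ν_pos : ∀ i, 0 < S.ν i
  γ_pos : ∀ i, 0 < S.γ i
  pre_div : Tendsto (fun n : ℕ => (S.pre n : ℝ) / (n : ℝ)) atTop (𝓝 0)
  θ_lt_μ : ∀ i, 1 < S.N i → S.θ i < S.μ i
  offset_ne : ∀ i j j', 1 ≤ j → j ≤ S.N i → 1 ≤ j' → j' ≤ S.N (other i) →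
    S.offset i j j' ≠ 0 ∧ S.offset i j j' ≠ S.θ i ∧ S.offset i j j' ≠ -S.θ (other i) ∧
      S.offset i j j' ≠ S.θ i - S.θ (other i)

lemma offset_eq (i : Fin 2) (j j' : ℕ) :
    S.offset i j j' = S.pos (other i) j' - S.pos i j := by
  rw [offset, pos, pos]; ring

/-- The scaled length of the part of the `j`-th codeword after the `j'`-th and before the next
burst of the other user. -/
def gapLength (i : Fin 2) (j j' : ℕ) : ℝ :=
  max ((if j' = S.N (other i) then S.pos i j + S.θ i else
      min (S.pos i j + S.θ i) (S.pos (other i) (j' + 1))) -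
    (if j' = 0 then S.pos i j else max (S.pos i j) (S.pos (other i) j' + S.θ (other i)))) 0

variable {S}

lemma Regular.tendsto_time (h : S.Regular) {i : Fin 2} {j : ℕ} (hj1 : 1 ≤ j) (hj : j ≤ S.N i) :
    Tendsto (fun p : ℕ × (Fin 2 → ℕ → Bool) => (S.time p.1 p.2 i j : ℝ) / p.1)
      (whp S.arrivalLaw) (𝓝 (S.pos i j)) :=
  S.tendsto_burstTime_div h.pre_div (h.k_pos i) (h.N_pos i) (h.q_pos i) (h.θ_pos i) (h.ν_pos i)
    (h.θ_lt_μ i) hj1 hj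

lemma Regular.tendsto_time_pre (h : S.Regular) {i : Fin 2} {j : ℕ} (hj1 : 1 ≤ j)
    (hj : j ≤ S.N i) :
    Tendsto (fun p : ℕ × (Fin 2 → ℕ → Bool) => ((S.time p.1 p.2 i j + S.pre p.1 : ℕ) : ℝ) / p.1)
      (whp S.arrivalLaw) (𝓝 (S.pos i j)) := by
  have := (h.tendsto_time hj1 hj).add (h.pre_div.comp (tendsto_fst_whp _))
  rw [add_zero] at this
  refine this.congr fun p => ?_
  simp [add_div]

lemma Regular.tendsto_time_end (h : S.Regular) {i : Fin 2} {j : ℕ} (hj1 : 1 ≤ j)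
    (hj : j ≤ S.N i) :
    Tendsto (fun p : ℕ × (Fin 2 → ℕ → Bool) =>
        ((S.time p.1 p.2 i j + S.pre p.1 + S.len p.1 i : ℕ) : ℝ) / p.1)
      (whp S.arrivalLaw) (𝓝 (S.pos i j + S.θ i)) := by
  have := (h.tendsto_time_pre hj1 hj).add
    ((S.tendsto_len_div (h.θ_pos i)).comp (tendsto_fst_whp S.arrivalLaw))
  refine this.congr fun p => ?_
  simp [add_div]

lemma Regular.pos_add_lt (h : S.Regular) {i : Fin 2} {j₁ j₂ : ℕ} (h₁ : 1 ≤ j₁) (h₁₂ : j₁ < j₂)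
    (h₂ : j₂ ≤ S.N i) : S.pos i j₁ + S.θ i < S.pos i j₂ := by
  have hlt := h.θ_lt_μ i (by omega)
  have : (j₁ : ℝ) + 1 ≤ j₂ := by exact_mod_cast h₁₂
  have hμ := S.μ_pos (h.k_pos i) (h.N_pos i) (h.q_pos i)
  rw [pos, pos]
  nlinarith

lemma Regular.eventually_ordered (h : S.Regular) (i : Fin 2) :
    ∀ᶠ p in whp S.arrivalLaw, S.Ordered p.1 p.2 i := by
  have : ∀ᶠ p in whp S.arrivalLaw, ∀ j₁ ∈ Finset.Icc 1 (S.N i), ∀ j₂ ∈ Finset.Ioc j₁ (S.N i),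
      S.time p.1 p.2 i j₁ + S.pre p.1 + S.len p.1 i ≤ S.time p.1 p.2 i j₂ := by
    simp only [Filter.eventually_all_finset]
    intro j₁ h₁ j₂ h₂
    rw [Finset.mem_Icc] at h₁
    rw [Finset.mem_Ioc] at h₂
    filter_upwards [(h.tendsto_time_end h₁.1 h₁.2).eventually_lt
      (h.tendsto_time (i := i) (j := j₂) (by omega) h₂.2) (h.pos_add_lt h₁.1 h₂.1 h₂.2),
      (tendsto_fst_whp S.arrivalLaw).eventually_gt_atTop 0] with p hp hn
    have hn' : (0 : ℝ) < p.1 := by exact_mod_cast hn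
    rw [div_lt_div_iff_of_pos_right hn'] at hp
    exact_mod_cast hp.le
  filter_upwards [this] with p hp j₁ j₂ h₁ h₁₂ h₂
  exact hp j₁ (Finset.mem_Icc.2 ⟨h₁, by omega⟩) j₂ (Finset.mem_Ioc.2 ⟨h₁₂, h₂⟩)

lemma tendsto_max_div {β : Type*} {l : Filter (ℕ × β)} {P Q : ℕ × β → ℕ} {p q : ℝ}
    (hP : Tendsto (fun x => (P x : ℝ) / x.1) l (𝓝 p))
    (hQ : Tendsto (fun x => (Q x : ℝ) / x.1) l (𝓝 q)) :
    Tendsto (fun x => ((max (P x) (Q x) : ℕ) : ℝ) / x.1) l (𝓝 (max p q)) := by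
  refine (hP.max hQ).congr fun x => ?_
  rw [max_div_div_right (Nat.cast_nonneg _), Nat.cast_max]

lemma tendsto_min_div {β : Type*} {l : Filter (ℕ × β)} {P Q : ℕ × β → ℕ} {p q : ℝ}
    (hP : Tendsto (fun x => (P x : ℝ) / x.1) l (𝓝 p))
    (hQ : Tendsto (fun x => (Q x : ℝ) / x.1) l (𝓝 q)) :
    Tendsto (fun x => ((min (P x) (Q x) : ℕ) : ℝ) / x.1) l (𝓝 (min p q)) := by
  refine (hP.min hQ).congr fun x => ?_
  rw [min_div_div_right (Nat.cast_nonneg _), Nat.cast_min]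

/-- The limits of the two ends could coincide only if one burst ends where the other begins, that is
for the offsets `θ i` and `-θ (other i)`. -/
lemma Regular.exists_eventually_le_card_overlap (h : S.Regular) {i : Fin 2} {j : ℕ}
    (hj1 : 1 ≤ j) (hj : j ≤ S.N i) :
    ∃ κ : ℝ, 0 < κ ∧ ∀ᶠ p in whp S.arrivalLaw, ∀ j' ∈ Finset.Icc 1 (S.N (other i)),
      (S.overlap p.1 p.2 i j j').Nonempty → κ * p.1 ≤ ((S.overlap p.1 p.2 i j j').card : ℝ) := by
  refine exists_pos_forall_eventually_of_antitone _ (p := fun j' κ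
    (p : ℕ × (Fin 2 → ℕ → Bool)) => (S.overlap p.1 p.2 i j j').Nonempty →
      κ * p.1 ≤ ((S.overlap p.1 p.2 i j j').card : ℝ)) ?_ ?_
  · intro _ _ κ κ' p hκ hp hne
    exact (mul_le_mul_of_nonneg_right hκ (Nat.cast_nonneg _)).trans (hp hne)
  · intro j' hj'
    rw [Finset.mem_Icc] at hj'
    obtain ⟨-, h2, h3, -⟩ := h.offset_ne i j j' hj1 hj hj'.1 hj'.2
    rw [offset_eq] at h2 h3
    have hθ := h.θ_pos i
    have hθ' := h.θ_pos (other i)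
    refine exists_eventually_Ioc_empty_or_le_card (tendsto_fst_whp _)
      (tendsto_max_div (h.tendsto_time_pre hj1 hj) (h.tendsto_time hj'.1 hj'.2))
      (tendsto_min_div (h.tendsto_time_end hj1 hj) (h.tendsto_time_end hj'.1 hj'.2)) ?_
    rcases max_choice (S.pos i j) (S.pos (other i) j') with e | e <;>
    rcases min_choice (S.pos i j + S.θ i) (S.pos (other i) j' + S.θ (other i)) with e' | e' <;>
    rw [e, e'] <;> intro heq
    · linarith
    · exact h3 (by linarith)
    · exact h2 (by linarith)
    · linarith

lemma Regular.tendsto_gap_ends (h : S.Regular) {i : Fin 2} {j j' : ℕ} (hj1 : 1 ≤ j)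
    (hj : j ≤ S.N i) (hj' : j' ≤ S.N (other i)) :
    Tendsto (fun p : ℕ × (Fin 2 → ℕ → Bool) =>
      ((if j' = 0 then S.time p.1 p.2 i j + S.pre p.1 else
        max (S.time p.1 p.2 i j + S.pre p.1)
          (S.time p.1 p.2 (other i) j' + S.pre p.1 + S.len p.1 (other i)) : ℕ) : ℝ) / p.1)
      (whp S.arrivalLaw)
      (𝓝 (if j' = 0 then S.pos i j else max (S.pos i j) (S.pos (other i) j' + S.θ (other i)))) ∧
    Tendsto (fun p : ℕ × (Fin 2 → ℕ → Bool) =>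
      ((if j' = S.N (other i) then S.time p.1 p.2 i j + S.pre p.1 + S.len p.1 i else
        min (S.time p.1 p.2 i j + S.pre p.1 + S.len p.1 i)
          (S.time p.1 p.2 (other i) (j' + 1)) : ℕ) : ℝ) / p.1)
      (whp S.arrivalLaw)
      (𝓝 (if j' = S.N (other i) then S.pos i j + S.θ i else
        min (S.pos i j + S.θ i) (S.pos (other i) (j' + 1)))) := by
  constructor
  · split_ifs with h0
    · exact h.tendsto_time_pre hj1 hj
    · exact tendsto_max_div (h.tendsto_time_pre hj1 hj)
        (h.tendsto_time_end (Nat.one_le_iff_ne_zero.2 h0) hj')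
  · split_ifs with h0
    · exact h.tendsto_time_end hj1 hj
    · exact tendsto_min_div (h.tendsto_time_end hj1 hj) (h.tendsto_time (by omega) (by omega))

lemma Regular.tendsto_card_gap (h : S.Regular) {i : Fin 2} {j j' : ℕ} (hj1 : 1 ≤ j)
    (hj : j ≤ S.N i) (hj' : j' ≤ S.N (other i)) :
    Tendsto (fun p : ℕ × (Fin 2 → ℕ → Bool) => ((S.gap p.1 p.2 i j j').card : ℝ) / p.1)
      (whp S.arrivalLaw) (𝓝 (S.gapLength i j j')) :=
  have e := h.tendsto_gap_ends hj1 hj hj'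
  tendsto_card_Ioc_div e.1 e.2

/-- Here the offsets `0` and `θ i - θ (other i)` are the critical ones: a gap shrinks to a point
only if the codeword and a burst begin together or end together. Two consecutive bursts cannot close
a gap, by `Regular.pos_add_lt`. -/
lemma Regular.exists_eventually_le_card_gap (h : S.Regular) {i : Fin 2} {j : ℕ}
    (hj1 : 1 ≤ j) (hj : j ≤ S.N i) :
    ∃ κ : ℝ, 0 < κ ∧ ∀ᶠ p in whp S.arrivalLaw, ∀ j' ∈ Finset.range (S.N (other i) + 1),
      (S.gap p.1 p.2 i j j').Nonempty → κ * p.1 ≤ ((S.gap p.1 p.2 i j j').card : ℝ) := by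
  refine exists_pos_forall_eventually_of_antitone _ (p := fun j' κ
    (p : ℕ × (Fin 2 → ℕ → Bool)) => (S.gap p.1 p.2 i j j').Nonempty →
      κ * p.1 ≤ ((S.gap p.1 p.2 i j j').card : ℝ)) ?_ ?_
  · intro _ _ κ κ' p hκ hp hne
    exact (mul_le_mul_of_nonneg_right hκ (Nat.cast_nonneg _)).trans (hp hne)
  · intro j' hj'
    rw [Finset.mem_range] at hj'
    have hθ := h.θ_pos i
    have hN := h.N_pos (other i)
    have e := h.tendsto_gap_ends hj1 hj (Nat.lt_succ_iff.1 hj')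
    refine exists_eventually_Ioc_empty_or_le_card (tendsto_fst_whp _) e.1 e.2 ?_
    have hl : j' ≠ 0 → S.pos (other i) j' + S.θ (other i) = S.pos i j + S.θ i → False := by
      intro h0 heq
      refine (h.offset_ne i j j' hj1 hj (by omega) (by omega)).2.2.2 ?_
      rw [offset_eq]; linarith
    have hr : j' ≠ S.N (other i) → S.pos i j = S.pos (other i) (j' + 1) → False := by
      intro h0 heq
      refine (h.offset_ne i j (j' + 1) hj1 hj (by omega) (by omega)).1 ?_
      rw [offset_eq]; linarith
    split_ifs with h0 h1 h1
    · linarith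
    · rcases min_choice (S.pos i j + S.θ i) (S.pos (other i) (j' + 1)) with e' | e' <;> rw [e'] <;>
        intro heq
      · linarith
      · exact hr h1 heq
    · rcases max_choice (S.pos i j) (S.pos (other i) j' + S.θ (other i)) with e | e <;> rw [e] <;>
        intro heq
      · linarith
      · exact hl h0 heq
    · rcases max_choice (S.pos i j) (S.pos (other i) j' + S.θ (other i)) with e | e <;>
      rcases min_choice (S.pos i j + S.θ i) (S.pos (other i) (j' + 1)) with e' | e' <;>
      rw [e, e'] <;> intro heq
      · linarith
      · exact hr h1 heq
      · exact hl h0 heq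
      · exact (h.pos_add_lt (i := other i) (j₁ := j') (j₂ := j' + 1) (by omega) (by omega)
          (by omega)).ne heq

end System

/-! ### The received signal in terms of the Gaussian symbols -/

lemma other_ne (i : Fin 2) : other i ≠ i := by
  fin_cases i <;> decide

lemma jointlyTypical_congr {ε : ℝ} {p : ℝ × ℝ → ℝ} {T : Finset ℕ} {x x' y y' : ℕ → ℝ}
    (hx : ∀ t ∈ T, x t = x' t) (hy : ∀ t ∈ T, y t = y' t) :
    JointlyTypical ε p T x y ↔ JointlyTypical ε p T x' y' := by
  have h1 : ∑ t ∈ T, Real.logb 2 (fstMarginal p (x t)) =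
      ∑ t ∈ T, Real.logb 2 (fstMarginal p (x' t)) :=
    Finset.sum_congr rfl fun t ht => by rw [hx t ht]
  have h2 : ∑ t ∈ T, Real.logb 2 (sndMarginal p (y t)) =
      ∑ t ∈ T, Real.logb 2 (sndMarginal p (y' t)) :=
    Finset.sum_congr rfl fun t ht => by rw [hy t ht]
  have h3 : ∑ t ∈ T, Real.logb 2 (p (x t, y t)) = ∑ t ∈ T, Real.logb 2 (p (x' t, y' t)) :=
    Finset.sum_congr rfl fun t ht => by rw [hx t ht, hy t ht]
  rw [JointlyTypical, JointlyTypical, h1, h2, h3]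

namespace System

variable (S : System)

lemma clearDensity_eq (i : Fin 2) : S.clearDensity i = pairDensity (S.γ i) 1 := rfl

lemma interferedDensity_eq (i : Fin 2) : S.interferedDensity i =
    pairDensity (S.γ i) (1 + S.a (other i) * S.γ (other i)) := rfl

/-- The index of the symbol number `l` of a burst of user `i` with message `m`; the value past the
end of the burst is `d`. -/
def burstIndex (n : ℕ) (i : Fin 2) (m : Fin (2 ^ S.bits n i)) (d : S.Coord n) (l : ℕ) :
    S.Coord n :=
  if h : l < S.pre n then .inr (.inl ⟨i, l, h⟩)
  else if h : l - S.pre n < S.len n i then .inl ⟨i, m, l - S.pre n, h⟩ else d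

/-- The index of the symbol in slot `t` of the codeword of the message `m`, if this is sent as the
`j`-th codeword of user `i`. -/
def codeIndex (n : ℕ) (B : Fin 2 → ℕ → Bool) (i : Fin 2) (j : ℕ) (m : Fin (2 ^ S.bits n i))
    (t : ℕ) : S.Coord n :=
  if h : t - (S.time n B i j + S.pre n + 1) < S.len n i then
    .inl ⟨i, m, t - (S.time n B i j + S.pre n + 1), h⟩ else .inr (.inr ⟨i, t⟩)

open Classical in
/-- The index of the symbol that interferes with the `j`-th codeword of user `i` in slot `t`; an
unused noise symbol if there is no interference. -/
def interfererIndex (n : ℕ) (w : S.Messages n) (B : Fin 2 → ℕ → Bool) (i : Fin 2) (j : ℕ)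
    (t : ℕ) : S.Coord n :=
  if h : ∃ j' ∈ Finset.Icc 1 (S.N (other i)), t ∈ S.overlap n B i j j' then
    S.burstIndex n (other i) (w (other i) h.choose) (.inr (.inr ⟨other i, t⟩))
      (t - (S.time n B (other i) h.choose + 1))
  else .inr (.inr ⟨other i, t⟩)

open Classical in
/-- The squared gain of the interference in slot `t`. -/
def gain (n : ℕ) (B : Fin 2 → ℕ → Bool) (i : Fin 2) (j : ℕ) (t : ℕ) : ℝ≥0 :=
  if ∃ j' ∈ Finset.Icc 1 (S.N (other i)), t ∈ S.overlap n B i j j' then S.a (other i) else 0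

/-- The variance of noise and interference in slot `t`. -/
def noiseVar (n : ℕ) (w : S.Messages n) (B : Fin 2 → ℕ → Bool) (i : Fin 2) (j : ℕ) (t : ℕ) :
    ℝ≥0 :=
  S.gain n B i j t * S.coordVar n (S.interfererIndex n w B i j t) + 1

/-- The received signal in the slots of the `j`-th codeword, as a function of the symbols. -/
def codeOutput (n : ℕ) (w : S.Messages n) (B : Fin 2 → ℕ → Bool) (i : Fin 2) (j : ℕ)
    (r : S.Symbols n) (t : ℕ) : ℝ :=
  S.coord n (S.codeIndex n B i j (w i j) t) r +
    √(S.gain n B i j t : ℝ) * S.coord n (S.interfererIndex n w B i j t) r +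
    S.coord n (.inr (.inr ⟨i, t⟩)) r

variable {S} {n : ℕ} {w : S.Messages n} {B : Fin 2 → ℕ → Bool} {i : Fin 2} {j : ℕ}

lemma exists_codeIndex_eq {m : Fin (2 ^ S.bits n i)} {t : ℕ} (ht : t ∈ S.codeSlots n B i j) :
    ∃ h : t - (S.time n B i j + S.pre n + 1) < S.len n i, S.codeIndex n B i j m t =
      .inl ⟨i, m, t - (S.time n B i j + S.pre n + 1), h⟩ := by
  rw [codeSlots, Finset.mem_Ioc] at ht
  have h : t - (S.time n B i j + S.pre n + 1) < S.len n i := by omega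
  exact ⟨h, by rw [codeIndex, dif_pos h]⟩

lemma placed_eq (r : S.Symbols n) {m : Fin (2 ^ S.bits n i)} {t : ℕ}
    (ht : t ∈ S.codeSlots n B i j) :
    S.placed n (B, r) i j (r.1 i m) t = S.coord n (S.codeIndex n B i j m t) r := by
  obtain ⟨h, e⟩ := exists_codeIndex_eq (m := m) ht
  rw [e, placed]
  exact dif_pos h

lemma burstSymbol_eq_coord (r : S.Symbols n) {m : Fin (2 ^ S.bits n i)} (d : S.Coord n) {l : ℕ}
    (hl : l < S.pre n + S.len n i) :
    S.burstSymbol n i (r.2.1 i) (r.1 i m) l = S.coord n (S.burstIndex n i m d l) r := by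
  rw [burstSymbol, burstIndex]
  by_cases h : l < S.pre n
  · rw [dif_pos h, dif_pos h]; rfl
  · have h' : l - S.pre n < S.len n i := by omega
    rw [dif_neg h, dif_neg h, dif_pos h', dif_pos h']; rfl

lemma burstSymbol_eq_zero {s' : Fin (S.pre n) → ℝ} {s : Fin (S.len n i) → ℝ} {l : ℕ}
    (hl : S.pre n + S.len n i ≤ l) : S.burstSymbol n i s' s l = 0 := by
  rw [burstSymbol, dif_neg (by omega), dif_neg (by omega)]

lemma signal_eq_zero (w : S.Messages n) (r : S.Symbols n) {t : ℕ}
    (h : ∀ j' ∈ Finset.Icc 1 (S.N i), S.time n B i j' < t →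
      S.time n B i j' + S.pre n + S.len n i < t) : S.signal n w (B, r) i t = 0 := by
  refine Finset.sum_eq_zero fun j' hj' => ?_
  split_ifs with ht
  · change S.time n B i j' + 1 ≤ t at ht
    have := h j' hj' (by omega)
    refine burstSymbol_eq_zero ?_
    change S.pre n + S.len n i ≤ t - (S.time n B i j' + 1)
    omega
  · rfl

lemma signal_eq_burstSymbol (hO : S.Ordered n B i) (w : S.Messages n) (r : S.Symbols n) {t : ℕ}
    (hj : j ∈ Finset.Icc 1 (S.N i)) (h1 : S.time n B i j < t)
    (h2 : t ≤ S.time n B i j + S.pre n + S.len n i) :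
    S.signal n w (B, r) i t =
      S.burstSymbol n i (r.2.1 i) (r.1 i (w i j)) (t - (S.time n B i j + 1)) := by
  rw [signal, Finset.sum_eq_single_of_mem j hj]
  · exact if_pos (show S.time n B i j + 1 ≤ t by omega)
  · intro j' hj' hne
    rw [Finset.mem_Icc] at hj hj'
    split_ifs with ht
    · change S.time n B i j' + 1 ≤ t at ht
      refine burstSymbol_eq_zero ?_
      change S.pre n + S.len n i ≤ t - (S.time n B i j' + 1)
      rcases hne.lt_or_gt with hlt | hlt
      · have := hO j' j hj'.1 hlt hj.2; omega
      · have := hO j j' hj.1 hlt hj'.2; omega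
    · rfl

lemma interfererIndex_of_mem_overlap (hO : S.Ordered n B (other i)) {j' : ℕ}
    (hj' : j' ∈ Finset.Icc 1 (S.N (other i))) {t : ℕ} (ht : t ∈ S.overlap n B i j j') :
    S.interfererIndex n w B i j t = S.burstIndex n (other i) (w (other i) j')
      (.inr (.inr ⟨other i, t⟩)) (t - (S.time n B (other i) j' + 1)) := by
  have h : ∃ j' ∈ Finset.Icc 1 (S.N (other i)), t ∈ S.overlap n B i j j' := ⟨j', hj', ht⟩
  have hc : h.choose = j' := by
    by_contra hne
    exact Finset.disjoint_left.1 (disjoint_overlap hO h.choose_spec.1 hj' hne)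
      h.choose_spec.2 ht
  rw [interfererIndex, dif_pos h, hc]

lemma gain_of_mem_overlap {j' : ℕ} (hj' : j' ∈ Finset.Icc 1 (S.N (other i))) {t : ℕ}
    (ht : t ∈ S.overlap n B i j j') : S.gain n B i j t = S.a (other i) :=
  if_pos ⟨j', hj', ht⟩

lemma not_exists_mem_overlap_of_mem_gap (hO : S.Ordered n B (other i)) {j' : ℕ}
    (hj' : j' ∈ Finset.range (S.N (other i) + 1)) {t : ℕ} (ht : t ∈ S.gap n B i j j') :
    ¬ ∃ j' ∈ Finset.Icc 1 (S.N (other i)), t ∈ S.overlap n B i j j' := by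
  rintro ⟨j₁, h₁, ht₁⟩
  exact Finset.disjoint_left.1 (disjoint_overlap_gap hO h₁ hj') ht₁ ht

lemma interfererIndex_of_mem_gap (hO : S.Ordered n B (other i)) {j' : ℕ}
    (hj' : j' ∈ Finset.range (S.N (other i) + 1)) {t : ℕ} (ht : t ∈ S.gap n B i j j') :
    S.interfererIndex n w B i j t = .inr (.inr ⟨other i, t⟩) :=
  dif_neg (not_exists_mem_overlap_of_mem_gap hO hj' ht)

lemma gain_of_mem_gap (hO : S.Ordered n B (other i)) {j' : ℕ}
    (hj' : j' ∈ Finset.range (S.N (other i) + 1)) {t : ℕ} (ht : t ∈ S.gap n B i j j') :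
    S.gain n B i j t = 0 :=
  if_neg (not_exists_mem_overlap_of_mem_gap hO hj' ht)

lemma coordVar_burstIndex {m : Fin (2 ^ S.bits n i)} {d : S.Coord n} {l : ℕ}
    (hl : l < S.pre n + S.len n i) : S.coordVar n (S.burstIndex n i m d l) = S.γ i := by
  rw [burstIndex]
  by_cases h : l < S.pre n
  · rw [dif_pos h]; rfl
  · rw [dif_neg h, dif_pos (by omega)]; rfl

lemma noiseVar_of_mem_overlap (hO : S.Ordered n B (other i)) {j' : ℕ}
    (hj' : j' ∈ Finset.Icc 1 (S.N (other i))) {t : ℕ} (ht : t ∈ S.overlap n B i j j') :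
    S.noiseVar n w B i j t = 1 + S.a (other i) * S.γ (other i) := by
  rw [noiseVar, gain_of_mem_overlap hj' ht, interfererIndex_of_mem_overlap hO hj' ht,
    coordVar_burstIndex, add_comm]
  simp only [overlap, Finset.mem_Ioc, max_lt_iff, le_min_iff] at ht
  omega

lemma noiseVar_of_mem_gap (hO : S.Ordered n B (other i)) {j' : ℕ}
    (hj' : j' ∈ Finset.range (S.N (other i) + 1)) {t : ℕ} (ht : t ∈ S.gap n B i j j') :
    S.noiseVar n w B i j t = 1 := by
  rw [noiseVar, gain_of_mem_gap hO hj' ht, zero_mul, zero_add]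

/-- In each slot the received value is own symbol plus gain times one other symbol plus noise. On a
gap the gain is `0`, so the dummy noise symbol contributes nothing. -/
lemma received_eq (hi : S.Ordered n B i) (hO : S.Ordered n B (other i)) (r : S.Symbols n)
    (hj : j ∈ Finset.Icc 1 (S.N i)) {t : ℕ} (ht : t ∈ S.codeSlots n B i j) :
    S.received n w (B, r) i t = S.codeOutput n w B i j r t := by
  have ht' := ht
  rw [codeSlots, Finset.mem_Ioc] at ht'
  have hown : S.signal n w (B, r) i t = S.coord n (S.codeIndex n B i j (w i j) t) r := by
    obtain ⟨h, e⟩ := exists_codeIndex_eq (m := w i j) ht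
    have h1 : t - (S.time n B i j + 1) - S.pre n < S.len n i := by omega
    have h2 : (⟨t - (S.time n B i j + 1) - S.pre n, h1⟩ : Fin (S.len n i)) =
        ⟨t - (S.time n B i j + S.pre n + 1), h⟩ := Fin.ext (by simp only; omega)
    rw [signal_eq_burstSymbol hi w r hj (by omega) (by omega), burstSymbol, dif_neg (by omega),
      dif_pos h1, h2, e]
    rfl
  have hother : √(S.a (other i) : ℝ) * S.signal n w (B, r) (other i) t =
      √(S.gain n B i j t : ℝ) * S.coord n (S.interfererIndex n w B i j t) r := by
    rcases exists_mem_overlap_or_mem_gap ht with ⟨j', hj', hmem⟩ | ⟨j', hj', hmem⟩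
    · rw [gain_of_mem_overlap hj' hmem, interfererIndex_of_mem_overlap hO hj' hmem]
      simp only [overlap, Finset.mem_Ioc, max_lt_iff, le_min_iff] at hmem
      rw [signal_eq_burstSymbol hO w r hj' hmem.1.2 hmem.2.2, ← burstSymbol_eq_coord]
      omega
    · rw [gain_of_mem_gap hO hj' hmem, signal_eq_zero w r, NNReal.coe_zero, Real.sqrt_zero,
        mul_zero, zero_mul]
      intro j₁ h₁ hlt
      by_contra hcon
      refine not_exists_mem_overlap_of_mem_gap hO hj' hmem ⟨j₁, h₁, ?_⟩
      simp only [overlap, Finset.mem_Ioc, max_lt_iff, le_min_iff]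
      omega
  rw [received, hown, hother, codeOutput]
  rfl

lemma interfererIndex_ne_inl (t : ℕ)
    (c : (_ : Fin (2 ^ S.bits n i)) × Fin (S.len n i)) :
    S.interfererIndex n w B i j t ≠ .inl ⟨i, c⟩ := by
  have := other_ne i
  unfold interfererIndex burstIndex
  split_ifs <;> simp [this]

lemma interfererIndex_ne_noise (t s : ℕ) :
    S.interfererIndex n w B i j t ≠ .inr (.inr ⟨i, s⟩) := by
  have := other_ne i
  unfold interfererIndex burstIndex
  split_ifs <;> simp [this]

lemma injOn_codeIndex (m : Fin (2 ^ S.bits n i)) :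
    Set.InjOn (S.codeIndex n B i j m) (S.codeSlots n B i j) := by
  intro s hs t ht hst
  obtain ⟨h1, e1⟩ := exists_codeIndex_eq (m := m) hs
  obtain ⟨h2, e2⟩ := exists_codeIndex_eq (m := m) ht
  rw [e1, e2] at hst
  simp only [Sum.inl.injEq, Sigma.mk.injEq, heq_eq_eq, Fin.mk.injEq, true_and] at hst
  rw [Finset.mem_coe, codeSlots, Finset.mem_Ioc] at hs ht
  omega

/-- A single burst uses each of its symbols once. This fails across segments, where the preamble, or
the codeword of a repeated message, can recur. -/
lemma injOn_interfererIndex_overlap (hO : S.Ordered n B (other i)) {j' : ℕ}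
    (hj' : j' ∈ Finset.Icc 1 (S.N (other i))) :
    Set.InjOn (S.interfererIndex n w B i j) (S.overlap n B i j j') := by
  intro s hs t ht hst
  rw [interfererIndex_of_mem_overlap hO hj' hs, interfererIndex_of_mem_overlap hO hj' ht,
    burstIndex, burstIndex] at hst
  simp only [Finset.mem_coe, overlap, Finset.mem_Ioc, max_lt_iff, le_min_iff] at hs ht
  split_ifs at hst <;> simp at hst <;> omega

lemma injOn_interfererIndex_gap (hO : S.Ordered n B (other i)) {j' : ℕ}
    (hj' : j' ∈ Finset.range (S.N (other i) + 1)) :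
    Set.InjOn (S.interfererIndex n w B i j) (S.gap n B i j j') := by
  intro s hs t ht hst
  rw [interfererIndex_of_mem_gap hO hj' hs, interfererIndex_of_mem_gap hO hj' ht] at hst
  simpa using hst

/-! ### The two kinds of errors, given the arrivals -/

lemma measure_not_jointlyTypical_codeword_le (hγ : S.γ i ≠ 0) {T : Finset ℕ} (hT : T.Nonempty)
    (hTW : T ⊆ S.codeSlots n B i j) (hinj : Set.InjOn (S.interfererIndex n w B i j) T)
    {g σ : ℝ≥0} (hσ : σ ≠ 0) (hg : ∀ t ∈ T, S.gain n B i j t = g)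
    (hv : ∀ t ∈ T, S.noiseVar n w B i j t = σ) {ε : ℝ} (hε : 0 < ε) :
    S.symbolLaw n {r | ¬ JointlyTypical ε (pairDensity (S.γ i) σ) T
        (fun t => S.coord n (S.codeIndex n B i j (w i j) t) r) (S.codeOutput n w B i j r)}
      ≤ ENNReal.ofReal ((sqVariance (S.γ i) + sqVariance (S.γ i + σ) + sqVariance σ) /
          (T.card * (Real.log 2 * ε) ^ 2)) := by
  classical
  have hcode : ∀ t ∈ T, ∃ l, S.codeIndex n B i j (w i j) t = .inl ⟨i, w i j, l⟩ := fun t ht =>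
    ⟨_, (exists_codeIndex_eq (hTW ht)).choose_spec⟩
  have hab : ∀ s t, s ∈ T →
      S.codeIndex n B i j (w i j) s ≠ S.interfererIndex n w B i j t := by
    intro s t hs
    obtain ⟨l, hl⟩ := hcode s hs
    rw [hl]
    exact (interfererIndex_ne_inl t _).symm
  have hac : ∀ s t, s ∈ T → S.codeIndex n B i j (w i j) s ≠ .inr (.inr ⟨i, t⟩) := by
    intro s t hs
    obtain ⟨l, hl⟩ := hcode s hs
    rw [hl]
    simp
  have key := measure_not_jointlyTypical_le (S.iIndepFun_coord n) (S.measurable_coord n)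
    (S.map_coord n) hT hγ hσ g (a := S.codeIndex n B i j (w i j))
    (b := S.interfererIndex n w B i j) (c := fun t => .inr (.inr ⟨i, t⟩))
    (fun t ht => hab t t ht) (fun t ht => hac t t ht) (fun t _ => interfererIndex_ne_noise t t)
    (fun t ht => by obtain ⟨l, hl⟩ := hcode t ht; rw [hl]; rfl)
    (fun t ht => by rw [← hv t ht, noiseVar, hg t ht]; rfl) ?_ hε
  · refine (measure_mono fun r hr => ?_).trans key
    intro hcon
    refine hr ((jointlyTypical_congr (fun _ _ => rfl) fun t ht => ?_).1 hcon)
    rw [codeOutput, hg t ht]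
  · intro s hs t ht hst
    have h1 : S.codeIndex n B i j (w i j) s ≠ S.codeIndex n B i j (w i j) t := fun h =>
      hst (injOn_codeIndex _ (hTW hs) (hTW ht) h)
    have h2 : S.interfererIndex n w B i j s ≠ S.interfererIndex n w B i j t := fun h =>
      hst (hinj hs ht h)
    have h3 := hab s t hs
    have h4 := hac s t hs
    have h5 := interfererIndex_ne_noise (w := w) (B := B) (i := i) (j := j) s t
    have h6 := (hab t s ht).symm
    have h7 := (hac t s ht).symm
    have h8 := (interfererIndex_ne_noise (w := w) (B := B) (i := i) (j := j) t s).symm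
    simp only [Finset.disjoint_left, Finset.mem_insert, Finset.mem_singleton]
    rintro x (rfl | rfl | rfl) <;> simp [*]

variable (S) in
/-- The exponent of the likelihood ratio of a codeword that passes the test. -/
def exponent (n : ℕ) (ε : ℝ) (B : Fin 2 → ℕ → Bool) (i : Fin 2) (j : ℕ) : ℝ :=
  ∑ j' ∈ Finset.Icc 1 (S.N (other i)), ((S.overlap n B i j j').card : ℝ) * (S.ψ i - 3 * ε) +
    ∑ j' ∈ Finset.range (S.N (other i) + 1), ((S.gap n B i j j').card : ℝ) * (S.φ i - 3 * ε)

lemma capacity_overlap (i : Fin 2) :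
    capacity ((S.γ i : ℝ) / ((1 + S.a (other i) * S.γ (other i) : ℝ≥0) : ℝ)) = S.ψ i := by
  rw [ψ]; push_cast; rfl

lemma capacity_gap (i : Fin 2) : capacity ((S.γ i : ℝ) / ((1 : ℝ≥0) : ℝ)) = S.φ i := by
  rw [φ]; simp

/-- The bounds of `JointlyTypical.le_sum_logb_densityRatio` add up over the partition; empty
segments contribute zero to both sides. -/
lemma exponent_le_of_passes (hγ : S.γ i ≠ 0) (hi : S.Ordered n B i)
    (hO : S.Ordered n B (other i)) (hj : j ∈ Finset.Icc 1 (S.N i)) {ε : ℝ} {r : S.Symbols n}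
    {m : Fin (2 ^ S.bits n i)} (h : S.Passes n ε w (B, r) i j m) :
    S.exponent n ε B i j ≤ ∑ t ∈ S.codeSlots n B i j, Real.logb 2 (densityRatio (S.γ i)
      (S.noiseVar n w B i j t) (S.coord n (S.codeIndex n B i j m t) r)
      (S.codeOutput n w B i j r t)) := by
  rw [sum_codeSlots hO, exponent]
  have hp : ∀ {T : Finset ℕ}, T ⊆ S.codeSlots n B i j → ∀ {p : ℝ × ℝ → ℝ},
      JointlyTypical ε p T (S.placed n (B, r) i j (r.1 i m)) (S.received n w (B, r) i) →
      JointlyTypical ε p T (fun t => S.coord n (S.codeIndex n B i j m t) r)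
        (S.codeOutput n w B i j r) := fun {T} hT {p} h =>
    (jointlyTypical_congr (fun t ht => placed_eq r (hT ht))
      fun t ht => received_eq hi hO r hj (hT ht)).1 h
  refine add_le_add (Finset.sum_le_sum fun j' hj' => ?_) (Finset.sum_le_sum fun j' hj' => ?_)
  · rcases (S.overlap n B i j j').eq_empty_or_nonempty with he | hne
    · simp [he]
    · have hj'' := Finset.mem_Icc.1 hj'
      have ht := h.1 j' hj''.1 hj''.2 (by rwa [interferedSegment_eq])
      rw [interferedSegment_eq, interferedDensity_eq] at ht
      have := (hp (S.overlap_subset _ _ _ _ _) ht).le_sum_logb_densityRatio hne hγ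
        (by positivity)
      rw [capacity_overlap] at this
      refine this.trans_eq (Finset.sum_congr rfl fun t ht => ?_)
      rw [noiseVar_of_mem_overlap hO hj' ht]
  · rcases (S.gap n B i j j').eq_empty_or_nonempty with he | hne
    · simp [he]
    · have ht := h.2 j' (Nat.lt_succ_iff.1 (Finset.mem_range.1 hj')) (by rwa [clearSegment_eq])
      rw [clearSegment_eq, clearDensity_eq] at ht
      have := (hp (S.gap_subset _ _ _ _ _) ht).le_sum_logb_densityRatio hne hγ one_ne_zero
      rw [capacity_gap] at this
      refine this.trans_eq (Finset.sum_congr rfl fun t ht => ?_)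
      rw [noiseVar_of_mem_gap hO hj' ht]

/-- The output is built from the sent codeword, the other user's symbols and noise, hence from
symbols disjoint from those of any other codeword of user `i`. -/
lemma measure_passes_le (hγ : S.γ i ≠ 0) (hi : S.Ordered n B i) (hO : S.Ordered n B (other i))
    (hj : j ∈ Finset.Icc 1 (S.N i)) (ε : ℝ) {m : Fin (2 ^ S.bits n i)} (hm : m ≠ w i j) :
    S.symbolLaw n {r | S.Passes n ε w (B, r) i j m}
      ≤ ENNReal.ofReal (2 ^ (-S.exponent n ε B i j)) := by
  classical
  set W := S.codeSlots n B i j with hW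
  set c := S.codeIndex n B i j (w i j) with hc
  set p := S.interfererIndex n w B i j with hp
  set z : ℕ → S.Coord n := fun t => .inr (.inr ⟨i, t⟩) with hz
  set D : Finset (S.Coord n) := W.image c ∪ (W.image p ∪ W.image z) with hD
  have hcD : ∀ t ∈ W, c t ∈ D := fun t ht =>
    Finset.mem_union_left _ (Finset.mem_image_of_mem _ ht)
  have hpD : ∀ t ∈ W, p t ∈ D := fun t ht =>
    Finset.mem_union_right _ (Finset.mem_union_left _ (Finset.mem_image_of_mem _ ht))
  have hzD : ∀ t ∈ W, z t ∈ D := fun t ht =>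
    Finset.mem_union_right _ (Finset.mem_union_right _ (Finset.mem_image_of_mem _ ht))
  have hdisj : Disjoint (W.image (S.codeIndex n B i j m)) D := by
    rw [Finset.disjoint_left]
    intro k hk hkD
    obtain ⟨t, ht, rfl⟩ := Finset.mem_image.1 hk
    obtain ⟨_, e⟩ := exists_codeIndex_eq (m := m) ht
    rw [e] at hkD
    simp only [hD, Finset.mem_union, Finset.mem_image] at hkD
    rcases hkD with ⟨s, hs, h⟩ | ⟨s, hs, h⟩ | ⟨s, hs, h⟩
    · obtain ⟨_, e'⟩ := exists_codeIndex_eq (m := w i j) hs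
      rw [hc, e'] at h
      simp only [Sum.inl.injEq, Sigma.mk.injEq, heq_eq_eq, true_and] at h
      exact hm h.1.symm
    · exact interfererIndex_ne_inl s _ h
    · simp [hz] at h
  have key := measure_le_sum_logb_densityRatio_le hγ (σ := S.noiseVar n w B i j)
    (fun t => by rw [noiseVar]; positivity) (S.iIndepFun_coord n) (S.measurable_coord n)
    (W := W) (a := S.codeIndex n B i j m) (injOn_codeIndex m)
    (fun t ht => by
      obtain ⟨_, e⟩ := exists_codeIndex_eq (m := m) ht
      rw [e, map_coord]; rfl) hdisj
    -- The output as a function of the symbols in `D`; its value outside `W` is irrelevant.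
    (h := fun t y => if ht : t ∈ W then y ⟨c t, hcD t ht⟩ +
      √(S.gain n B i j t : ℝ) * y ⟨p t, hpD t ht⟩ + y ⟨z t, hzD t ht⟩ else 0)
    (fun t => by
      by_cases ht : t ∈ W
      · simp only [dif_pos ht]; fun_prop
      · simp only [dif_neg ht]; fun_prop) (S.exponent n ε B i j)
  refine (measure_mono fun r hr => ?_).trans key
  refine (exponent_le_of_passes hγ hi hO hj hr).trans_eq (Finset.sum_congr rfl fun t ht => ?_)
  rw [dif_pos ht]
  rfl

end System

namespace System

variable {S : System} {n : ℕ} {w : S.Messages n} {B : Fin 2 → ℕ → Bool} {i : Fin 2} {j : ℕ}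

/-! ### The probability of error -/

variable (S) in
/-- The sum of the variances that occur in the typicality tests of receiver `i`. -/
def testVariance (i : Fin 2) : ℝ :=
  (sqVariance (S.γ i) + sqVariance (S.γ i + (1 + S.a (other i) * S.γ (other i))) +
      sqVariance (1 + S.a (other i) * S.γ (other i))) +
    (sqVariance (S.γ i) + sqVariance (S.γ i + 1) + sqVariance 1)

/-- A union bound: the sent codeword fails on one of the `N'` overlaps or `N' + 1` gaps, or one of
at most `2 ^ bits` wrong codewords passes. -/
lemma measure_error_le (hγ : S.γ i ≠ 0) (hi : S.Ordered n B i) (hO : S.Ordered n B (other i))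
    (hj : j ∈ Finset.Icc 1 (S.N i)) {ε κ : ℝ} (hε : 0 < ε) (hκ : 0 < κ) (hn : 0 < n)
    (h1 : ∀ j' ∈ Finset.Icc 1 (S.N (other i)), (S.overlap n B i j j').Nonempty →
      κ * n ≤ ((S.overlap n B i j j').card : ℝ))
    (h2 : ∀ j' ∈ Finset.range (S.N (other i) + 1), (S.gap n B i j j').Nonempty →
      κ * n ≤ ((S.gap n B i j j').card : ℝ)) :
    S.symbolLaw n {r | ¬ ∀ m, S.Passes n ε w (B, r) i j m ↔ m = w i j} ≤
      (S.N (other i) + (S.N (other i) + 1 : ℕ)) *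
        ENNReal.ofReal (S.testVariance i / (κ * n * (Real.log 2 * ε) ^ 2)) +
      ENNReal.ofReal (2 ^ ((S.bits n i : ℝ) - S.exponent n ε B i j)) := by
  classical
  have hl : 0 < Real.log 2 := Real.log_pos one_lt_two
  have hn' : (0 : ℝ) < n := by exact_mod_cast hn
  set b := ENNReal.ofReal (S.testVariance i / (κ * n * (Real.log 2 * ε) ^ 2)) with hb
  set X : S.Symbols n → ℕ → ℝ := fun r t => S.coord n (S.codeIndex n B i j (w i j) t) r with hX
  have hnn := sqVariance_nonneg
  have hbound : ∀ {V c : ℝ}, 0 ≤ V → V ≤ S.testVariance i → κ * n ≤ c →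
      ENNReal.ofReal (V / (c * (Real.log 2 * ε) ^ 2)) ≤ b := by
    intro V c hV hVt hc
    refine ENNReal.ofReal_le_ofReal ?_
    have := hV.trans hVt
    gcongr
  set E1 : ℕ → Set (S.Symbols n) := fun j' => {r | (S.overlap n B i j j').Nonempty ∧
    ¬ JointlyTypical ε (S.interferedDensity i) (S.overlap n B i j j') (X r)
      (S.codeOutput n w B i j r)} with hE1
  set E2 : ℕ → Set (S.Symbols n) := fun j' => {r | (S.gap n B i j j').Nonempty ∧
    ¬ JointlyTypical ε (S.clearDensity i) (S.gap n B i j j') (X r)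
      (S.codeOutput n w B i j r)} with hE2
  set E3 : Fin (2 ^ S.bits n i) → Set (S.Symbols n) := fun m =>
    {r | m ≠ w i j ∧ S.Passes n ε w (B, r) i j m} with hE3
  have m1 : ∀ j' ∈ Finset.Icc 1 (S.N (other i)), S.symbolLaw n (E1 j') ≤ b := by
    intro j' hj'
    rcases (S.overlap n B i j j').eq_empty_or_nonempty with he | hne
    · simp [hE1, he]
    · refine (measure_mono fun r hr => hr.2).trans ((measure_not_jointlyTypical_codeword_le hγ hne
        (S.overlap_subset _ _ _ _ _) (injOn_interfererIndex_overlap hO hj') (by positivity)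
        (fun t ht => gain_of_mem_overlap hj' ht) (fun t ht => noiseVar_of_mem_overlap hO hj' ht)
        hε).trans (hbound ?_ ?_ (h1 j' hj' hne)))
      · linarith [hnn (S.γ i), hnn (S.γ i + (1 + S.a (other i) * S.γ (other i))),
          hnn (1 + S.a (other i) * S.γ (other i))]
      · rw [testVariance]
        linarith [hnn (S.γ i), hnn (S.γ i + 1), hnn 1]
  have m2 : ∀ j' ∈ Finset.range (S.N (other i) + 1), S.symbolLaw n (E2 j') ≤ b := by
    intro j' hj'
    rcases (S.gap n B i j j').eq_empty_or_nonempty with he | hne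
    · simp [hE2, he]
    · refine (measure_mono fun r hr => hr.2).trans ((measure_not_jointlyTypical_codeword_le hγ hne
        (S.gap_subset _ _ _ _ _) (injOn_interfererIndex_gap hO hj') one_ne_zero
        (fun t ht => gain_of_mem_gap hO hj' ht) (fun t ht => noiseVar_of_mem_gap hO hj' ht)
        hε).trans (hbound ?_ ?_ (h2 j' hj' hne)))
      · linarith [hnn (S.γ i), hnn (S.γ i + 1), hnn 1]
      · rw [testVariance]
        linarith [hnn (S.γ i), hnn (S.γ i + (1 + S.a (other i) * S.γ (other i))),
          hnn (1 + S.a (other i) * S.γ (other i))]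
  have m3 : ∀ m, S.symbolLaw n (E3 m) ≤ ENNReal.ofReal (2 ^ (-S.exponent n ε B i j)) := by
    intro m
    by_cases hm : m = w i j
    · simp [hE3, hm]
    · exact (measure_mono fun r hr => hr.2).trans (measure_passes_le hγ hi hO hj ε hm)
  have hsub : {r | ¬ ∀ m, S.Passes n ε w (B, r) i j m ↔ m = w i j} ⊆
      ((⋃ j' ∈ Finset.Icc 1 (S.N (other i)), E1 j') ∪
        ⋃ j' ∈ Finset.range (S.N (other i) + 1), E2 j') ∪ ⋃ m ∈ Finset.univ, E3 m := by
    intro r hr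
    by_contra hcon
    simp only [Set.mem_union, Set.mem_iUnion, not_or, not_exists] at hcon
    obtain ⟨⟨c1, c2⟩, c3⟩ := hcon
    refine hr fun m => ⟨fun hp => ?_, ?_⟩
    · by_contra hm
      exact c3 m (Finset.mem_univ _) ⟨hm, hp⟩
    · rintro rfl
      have hp : ∀ {T : Finset ℕ}, T ⊆ S.codeSlots n B i j → ∀ {p : ℝ × ℝ → ℝ},
          JointlyTypical ε p T (X r) (S.codeOutput n w B i j r) →
          JointlyTypical ε p T (S.placed n (B, r) i j (r.1 i (w i j)))
            (S.received n w (B, r) i) := fun {T} hT {p} h =>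
        (jointlyTypical_congr (fun t ht => placed_eq r (hT ht))
          fun t ht => received_eq hi hO r hj (hT ht)).2 h
      constructor
      · intro j' hj1 hj2 hne
        rw [interferedSegment_eq] at hne ⊢
        refine hp (S.overlap_subset _ _ _ _ _) ?_
        by_contra hjt
        exact c1 j' (Finset.mem_Icc.2 ⟨hj1, hj2⟩) ⟨hne, hjt⟩
      · intro j' hj2 hne
        rw [clearSegment_eq] at hne ⊢
        refine hp (S.gap_subset _ _ _ _ _) ?_
        by_contra hjt
        exact c2 j' (Finset.mem_range.2 (by omega)) ⟨hne, hjt⟩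
  have s1 : S.symbolLaw n (⋃ j' ∈ Finset.Icc 1 (S.N (other i)), E1 j') ≤ S.N (other i) * b :=
    (measure_biUnion_finset_le _ _).trans ((Finset.sum_le_card_nsmul _ _ _ m1).trans_eq
      (by simp))
  have s2 : S.symbolLaw n (⋃ j' ∈ Finset.range (S.N (other i) + 1), E2 j') ≤
      (S.N (other i) + 1 : ℕ) * b :=
    (measure_biUnion_finset_le _ _).trans ((Finset.sum_le_card_nsmul _ _ _ m2).trans_eq
      (by simp))
  have s3 : S.symbolLaw n (⋃ m ∈ Finset.univ, E3 m) ≤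
      ENNReal.ofReal (2 ^ ((S.bits n i : ℝ) - S.exponent n ε B i j)) := by
    refine (measure_biUnion_finset_le _ _).trans ((Finset.sum_le_card_nsmul _ _ _
      fun m _ => m3 m).trans_eq ?_)
    rw [Finset.card_univ, Fintype.card_fin, nsmul_eq_mul, sub_eq_add_neg,
      Real.rpow_add two_pos, ENNReal.ofReal_mul (by positivity), Real.rpow_natCast]
    congr 1
    rw [ENNReal.ofReal_pow (by norm_num)]
    simp
  refine (measure_mono hsub).trans ((measure_union_le _ _).trans (add_le_add ?_ s3))
  refine (measure_union_le _ _).trans ((add_le_add s1 s2).trans_eq ?_)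
  rw [add_mul]

/-- Whether a message passes the test depends on the arrivals only through the transmission
times. -/
lemma Passes.of_time_eq {B' : Fin 2 → ℕ → Bool} (hj : j ≤ S.N i)
    (h : ∀ i, ∀ j ≤ S.N i, S.time n B i j = S.time n B' i j) {ε : ℝ} {r : S.Symbols n}
    {m : Fin (2 ^ S.bits n i)} (hp : S.Passes n ε w (B, r) i j m) :
    S.Passes n ε w (B', r) i j m := by
  have hsig : ∀ i' t, S.signal n w (B', r) i' t = S.signal n w (B, r) i' t := by
    intro i' t
    refine Finset.sum_congr rfl fun j' hj' => ?_
    have : S.τ n (B', r) i' j' = S.τ n (B, r) i' j' := (h i' j' (Finset.mem_Icc.1 hj').2).symm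
    rw [this]
  have hrec : S.received n w (B', r) i = S.received n w (B, r) i := by
    ext t
    rw [received, received, hsig, hsig]
  have hτ : S.τ n (B', r) i j = S.τ n (B, r) i j := (h i j hj).symm
  have hpl : S.placed n (B', r) i j (r.1 i m) = S.placed n (B, r) i j (r.1 i m) := by
    ext t
    unfold placed
    simp only [hτ]
  have hint : ∀ j' ≤ S.N (other i),
      S.interferedSegment n (B', r) i j j' = S.interferedSegment n (B, r) i j j' := by
    intro j' hj'
    rw [interferedSegment_eq, interferedSegment_eq, overlap, overlap, h i j hj, h _ j' hj']
  have hcl : ∀ j' ≤ S.N (other i),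
      S.clearSegment n (B', r) i j j' = S.clearSegment n (B, r) i j j' := by
    intro j' hj'
    rw [clearSegment_eq, clearSegment_eq, gap, gap, h i j hj, h _ j' hj']
    split_ifs
    · rfl
    · rw [h _ (j' + 1) (by omega)]
    · rfl
    · rw [h _ (j' + 1) (by omega)]
  constructor
  · intro j' h1 h2 hne
    have := hp.1 j' h1 h2 (by rwa [← hint j' h2])
    rw [hint j' h2]
    change JointlyTypical ε _ _ (S.placed n (B', r) i j (r.1 i m)) _
    rw [hpl, hrec]
    exact this
  · intro j' h2 hne
    have := hp.2 j' h2 (by rwa [← hcl j' h2])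
    rw [hcl j' h2]
    change JointlyTypical ε _ _ (S.placed n (B', r) i j (r.1 i m)) _
    rw [hpl, hrec]
    exact this

/-- `measure_prod_le_of_slices` with `T` the finite table of burst times, which by
`Passes.of_time_eq` determines the slice of the error event. -/
lemma errorProb_le (hj : j ≤ S.N i) {ε : ℝ} {G : Set (Fin 2 → ℕ → Bool)} {b : ℝ≥0∞}
    (hG : ∀ B ∈ G, S.symbolLaw n {r | ¬ ∀ m, S.Passes n ε w (B, r) i j m ↔ m = w i j} ≤ b) :
    S.errorProb n ε w i j ≤ S.arrivalLaw Gᶜ + b := by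
  set T : (Fin 2 → ℕ → Bool) → (i : Fin 2) → Fin (S.N i + 1) → ℕ := fun B i k =>
    S.time n B i k with hT
  have hTm : Measurable T := by
    refine measurable_pi_iff.2 fun i => measurable_pi_iff.2 fun k => ?_
    exact (S.measurable_burstTime n i k).comp (measurable_pi_apply i)
  refine measure_prod_le_of_slices (T := T) (fun c => hTm (measurableSet_singleton c)) ?_ hG
  intro B B' r hBB' hr hcon
  have h : ∀ i, ∀ j ≤ S.N i, S.time n B i j = S.time n B' i j := fun i j hj =>
    congrFun (congrFun hBB' i) ⟨j, by omega⟩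
  refine hr fun m => ⟨fun hp => (hcon m).1 (hp.of_time_eq hj h), fun hm => ?_⟩
  exact ((hcon m).2 hm).of_time_eq hj fun i j hj => (h i j hj).symm

lemma ψ_le_φ (i : Fin 2) : S.ψ i ≤ S.φ i := by
  have h : (S.γ i : ℝ) / (1 + S.a (other i) * S.γ (other i)) ≤ S.γ i := by
    refine div_le_self (NNReal.coe_nonneg _) ?_
    have : (0 : ℝ) ≤ S.a (other i) * S.γ (other i) := by positivity
    linarith
  rw [ψ, φ, capacity, capacity]
  gcongr
  exact one_lt_two

/-- Treating interference as noise succeeds if the rate is below the average of the capacities of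
the segments. -/
theorem Regular.reliablyDecoded (h : S.Regular) (hj1 : 1 ≤ j) (hj : j ≤ S.N i)
    (hrate : S.η i < S.θ i * S.ψ i + (S.φ i - S.ψ i) *
      ∑ j' ∈ Finset.range (S.N (other i) + 1), S.gapLength i j j') :
    S.ReliablyDecoded i j := by
  set C := ∑ j' ∈ Finset.range (S.N (other i) + 1), S.gapLength i j j' with hC
  set Δ := S.θ i * S.ψ i + (S.φ i - S.ψ i) * C - S.η i with hΔ
  have hΔ0 : 0 < Δ := by rw [hΔ]; linarith
  have hθ := h.θ_pos i
  have hfst := tendsto_fst_whp S.arrivalLaw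
  -- The typicality slack costs `3 ε θ` of the rate margin `Δ`. This choice keeps it below `Δ / 2`,
  -- and the fluctuations of the segment lengths may use up another `Δ / 4`.
  refine ⟨Δ / (6 * S.θ i), by positivity, fun ε hε hεlt w => ?_⟩
  have hεΔ : 3 * ε * S.θ i < Δ / 2 := by
    rw [lt_div_iff₀ (by positivity)] at hεlt
    linarith
  obtain ⟨κ₁, hκ₁, hover⟩ := h.exists_eventually_le_card_overlap hj1 hj
  obtain ⟨κ₂, hκ₂, hgap⟩ := h.exists_eventually_le_card_gap hj1 hj
  set κ := min κ₁ κ₂ with hκ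
  have hκ0 : 0 < κ := lt_min hκ₁ hκ₂
  have hexp : ∀ᶠ p in whp S.arrivalLaw,
      Δ / 4 * p.1 ≤ S.exponent p.1 ε p.2 i j - S.bits p.1 i := by
    have hlen := ((S.tendsto_len_div hθ).comp hfst).const_mul (S.ψ i - 3 * ε)
    have hcl : Tendsto (fun p : ℕ × (Fin 2 → ℕ → Bool) =>
        ∑ j' ∈ Finset.range (S.N (other i) + 1), ((S.gap p.1 p.2 i j j').card : ℝ) / p.1)
        (whp S.arrivalLaw) (𝓝 C) :=
      tendsto_finsetSum _ fun j' hj' =>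
        h.tendsto_card_gap hj1 hj (Nat.lt_succ_iff.1 (Finset.mem_range.1 hj'))
    have hall := (hlen.add (hcl.const_mul (S.φ i - S.ψ i))).sub ((S.tendsto_bits_div i).comp hfst)
    filter_upwards [hall.eventually_const_lt (u := Δ / 4) (by rw [hΔ] at hεΔ ⊢; linarith),
      h.eventually_ordered (other i), hfst.eventually_gt_atTop 0] with p hp hO hn
    have hn' : (0 : ℝ) < p.1 := by exact_mod_cast hn
    -- Overlaps and gaps together have `len` slots, so the overlaps are eliminated: every slot earns
    -- `ψ - 3 ε`, and a clear slot earns `φ - ψ` on top. Only the gap lengths need a limit.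
    have he : S.exponent p.1 ε p.2 i j = (S.ψ i - 3 * ε) * S.len p.1 i + (S.φ i - S.ψ i) *
        ∑ j' ∈ Finset.range (S.N (other i) + 1), ((S.gap p.1 p.2 i j j').card : ℝ) := by
      rw [exponent, len_eq_sum_card (j := j) hO, ← Finset.sum_mul, ← Finset.sum_mul]
      ring
    simp only [Function.comp_apply, ← Finset.sum_div, ← mul_div_assoc, ← add_div, ← sub_div,
      lt_div_iff₀ hn'] at hp
    rw [he]
    exact hp.le
  set H : Set (ℕ × (Fin 2 → ℕ → Bool)) := {p |
    S.Ordered p.1 p.2 i ∧ S.Ordered p.1 p.2 (other i) ∧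
    (∀ j' ∈ Finset.Icc 1 (S.N (other i)), (S.overlap p.1 p.2 i j j').Nonempty →
      κ₁ * p.1 ≤ ((S.overlap p.1 p.2 i j j').card : ℝ)) ∧
    (∀ j' ∈ Finset.range (S.N (other i) + 1), (S.gap p.1 p.2 i j j').Nonempty →
      κ₂ * p.1 ≤ ((S.gap p.1 p.2 i j j').card : ℝ)) ∧
    Δ / 4 * p.1 ≤ S.exponent p.1 ε p.2 i j - S.bits p.1 i} with hH
  have hHwhp : Tendsto (fun n => S.arrivalLaw {B | (n, B) ∉ H}) atTop (𝓝 0) :=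
    (h.eventually_ordered i).and ((h.eventually_ordered (other i)).and
      (hover.and (hgap.and hexp)))
  set b : ℕ → ℝ≥0∞ := fun n => (S.N (other i) + (S.N (other i) + 1 : ℕ)) *
    ENNReal.ofReal (S.testVariance i / (κ * n * (Real.log 2 * ε) ^ 2)) +
      ENNReal.ofReal (2 ^ (-(Δ / 4 * n))) with hb
  have hb0 : Tendsto b atTop (𝓝 0) := by
    have t1 : Tendsto (fun n : ℕ => S.testVariance i / (κ * n * (Real.log 2 * ε) ^ 2))
        atTop (𝓝 0) := by
      have := (tendsto_one_div_atTop_nhds_zero_nat (𝕜 := ℝ)).const_mul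
        (S.testVariance i / (κ * (Real.log 2 * ε) ^ 2))
      rw [mul_zero] at this
      refine this.congr fun n => ?_
      rw [div_mul_div_comm, mul_one]
      ring_nf
    have t2 : Tendsto (fun n : ℕ => (2 : ℝ) ^ (-(Δ / 4 * n))) atTop (𝓝 0) := by
      have := tendsto_pow_atTop_nhds_zero_of_lt_one (r := (2 : ℝ) ^ (-(Δ / 4)))
        (by positivity) (Real.rpow_lt_one_of_one_lt_of_neg one_lt_two (by linarith))
      refine this.congr fun n => ?_
      rw [← Real.rpow_natCast, ← Real.rpow_mul (by norm_num), neg_mul]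
    have t1' := ENNReal.Tendsto.const_mul (a := ((S.N (other i) : ℝ≥0∞) +
      (S.N (other i) + 1 : ℕ))) (ENNReal.tendsto_ofReal t1) (Or.inr (by simp))
    have := t1'.add (ENNReal.tendsto_ofReal t2)
    rw [ENNReal.ofReal_zero, mul_zero, add_zero] at this
    exact this
  have hsum : Tendsto (fun n => S.arrivalLaw {B | (n, B) ∉ H} + b n) atTop (𝓝 0) := by
    simpa using hHwhp.add hb0
  refine tendsto_of_tendsto_of_tendsto_of_le_of_le' tendsto_const_nhds hsum
    (Eventually.of_forall fun _ => zero_le) ?_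
  filter_upwards [eventually_gt_atTop 0] with n hn
  have hn' : (0 : ℝ) < n := by exact_mod_cast hn
  refine errorProb_le hj (G := {B | (n, B) ∈ H}) fun B hB => ?_
  obtain ⟨hi, hO, g1, g2, g3⟩ := hB
  refine (measure_error_le (κ := κ) (h.γ_pos i).ne' hi hO (Finset.mem_Icc.2 ⟨hj1, hj⟩) hε hκ0 hn
    (fun j' hj' hne => le_trans ?_ (g1 j' hj' hne))
    (fun j' hj' hne => le_trans ?_ (g2 j' hj' hne))).trans ?_
  · exact mul_le_mul_of_nonneg_right (min_le_left _ _) hn'.le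
  · exact mul_le_mul_of_nonneg_right (min_le_right _ _) hn'.le
  · rw [hb]
    refine add_le_add le_rfl (ENNReal.ofReal_le_ofReal ?_)
    refine Real.rpow_le_rpow_of_exponent_le one_le_two ?_
    linarith

/-! ### The gaps between the bursts -/

lemma gapLength_nonneg (i : Fin 2) (j j' : ℕ) : 0 ≤ S.gapLength i j j' := le_max_right _ _

/-- A nonzero `ω⁻` or `ω⁺` is a genuine index, since `0` is the infimum of the empty set. -/
lemma sInf_mem_of_ne_zero {s : Set ℕ} (h : sInf s ≠ 0) : sInf s ∈ s :=
  Nat.sInf_mem (Set.nonempty_iff_ne_empty.2 fun he => h (by simp [he]))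

lemma Regular.le_sum_gapLength (h : S.Regular) (hminus : S.omegaMinus i j ≠ 0)
    (hplus : S.omegaPlus i j ≠ 0) (hne : S.omegaMinus i j ≠ S.omegaPlus i j) :
    (1 + (S.omega i j : ℝ)) * (S.μ (other i) - S.θ (other i)) ≤
      ∑ j' ∈ Finset.range (S.N (other i) + 1), S.gapLength i j j' := by
  obtain ⟨m1, m2, m3, m4⟩ := sInf_mem_of_ne_zero hminus
  obtain ⟨p1, p2, p3, p4⟩ := sInf_mem_of_ne_zero hplus
  change 1 ≤ S.omegaMinus i j at m1
  change S.omegaMinus i j ≤ _ at m2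
  change _ < S.offset i j (S.omegaMinus i j) at m3
  change S.offset i j (S.omegaMinus i j) < 0 at m4
  change 1 ≤ S.omegaPlus i j at p1
  change S.omegaPlus i j ≤ _ at p2
  change _ < S.offset i j (S.omegaPlus i j) at p3
  change S.offset i j (S.omegaPlus i j) < _ at p4
  set m := S.omegaMinus i j
  set p := S.omegaPlus i j
  have hμ0 := S.μ_pos (h.k_pos (other i)) (h.N_pos (other i)) (h.q_pos (other i))
  have hθ := h.θ_pos i
  have hlt := h.θ_lt_μ (other i) (by omega)
  have hpos : ∀ a b : ℕ, a < b → S.pos (other i) a + S.μ (other i) ≤ S.pos (other i) b := by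
    intro a b hab
    have : (a : ℝ) + 1 ≤ b := by exact_mod_cast hab
    rw [pos, pos]
    nlinarith
  have hmono : ∀ a b : ℕ, a ≤ b → S.pos (other i) a ≤ S.pos (other i) b := by
    intro a b hab
    rcases hab.eq_or_lt with rfl | hlt
    · exact le_rfl
    · linarith [hpos a b hlt]
  rw [offset_eq] at m3 m4 p3 p4
  -- In the opposite order the later burst would begin before the codeword does, while the earlier
  -- one is still on after its end; this contradicts `θ' < μ'`.
  have hmp : m < p := by
    by_contra hcon
    have := hpos p m (by omega)
    linarith
  have hgap : ∀ j' ∈ Finset.Ico m p, S.μ (other i) - S.θ (other i) ≤ S.gapLength i j j' := by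
    intro j' hj'
    rw [Finset.mem_Ico] at hj'
    have e1 := hmono _ _ hj'.1
    have e2 := hmono (j' + 1) p hj'.2
    refine le_max_of_le_left ?_
    -- Burst `m` ends after the codeword begins and burst `p` begins before the codeword ends, so
    -- the gaps from `m` up to `p` are not truncated by the codeword.
    rw [if_neg (by omega), if_neg (by omega), min_eq_right (by linarith),
      max_eq_right (by linarith)]
    have := hpos j' (j' + 1) (by omega)
    linarith
  -- A burst contained in the codeword begins after burst `m` and before burst `p`.
  have hcard : S.omega i j ≤ p - m - 1 := by
    rw [omega, ← Nat.card_Ioo]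
    refine Finset.card_le_card fun j' hj' => ?_
    rw [Finset.mem_filter, offset_eq] at hj'
    obtain ⟨-, h1, h2⟩ := hj'
    rw [Finset.mem_Ioo]
    constructor
    · by_contra hcon
      linarith [hmono j' m (by omega)]
    · by_contra hcon
      linarith [hmono p j' (by omega)]
  calc (1 + (S.omega i j : ℝ)) * (S.μ (other i) - S.θ (other i))
      ≤ ((p - m : ℕ) : ℝ) * (S.μ (other i) - S.θ (other i)) := by
        refine mul_le_mul_of_nonneg_right ?_ (by linarith)
        have : 1 + S.omega i j ≤ p - m := by omega
        exact_mod_cast this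
    _ = ∑ j' ∈ Finset.Ico m p, (S.μ (other i) - S.θ (other i)) := by
        rw [Finset.sum_const, Nat.card_Ico, nsmul_eq_mul]
    _ ≤ ∑ j' ∈ Finset.Ico m p, S.gapLength i j j' := Finset.sum_le_sum hgap
    _ ≤ _ := by
        refine Finset.sum_le_sum_of_subset_of_nonneg (fun j' hj' => ?_)
          fun j' _ _ => gapLength_nonneg i j j'
        rw [Finset.mem_Ico] at hj'
        rw [Finset.mem_range]
        omega

/-- Exchanging the users negates the offset, and negation carries the excluded set of user `0` to
that of user `1`; `θ i` and `-θ (other i)` trade places. -/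
lemma offset_ne_of_zero {S : System} (hends : ∀ j₁ j₂ : ℕ, 1 ≤ j₁ → j₁ ≤ S.N 0 → 1 ≤ j₂ →
      j₂ ≤ S.N 1 → (j₂ : ℝ) * S.μ 1 - (j₁ : ℝ) * S.μ 0 + S.ν 1 - S.ν 0 ∉
        ({0, S.θ 0, -S.θ 1, S.θ 0 - S.θ 1} : Set ℝ)) (i : Fin 2) (j j' : ℕ) (h1 : 1 ≤ j)
    (h2 : j ≤ S.N i) (h3 : 1 ≤ j') (h4 : j' ≤ S.N (other i)) :
    S.offset i j j' ≠ 0 ∧ S.offset i j j' ≠ S.θ i ∧ S.offset i j j' ≠ -S.θ (other i) ∧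
      S.offset i j j' ≠ S.θ i - S.θ (other i) := by
  have hi : i = 0 ∨ i = 1 := by fin_cases i <;> simp
  rcases hi with rfl | rfl
  · change j' ≤ S.N 1 at h4
    have := hends j j' h1 h2 h3 h4
    simp only [Set.mem_insert_iff, Set.mem_singleton_iff, not_or] at this
    exact this
  · change j' ≤ S.N 0 at h4
    have := hends j' j h3 h4 h1 h2
    simp only [Set.mem_insert_iff, Set.mem_singleton_iff, not_or] at this
    obtain ⟨a1, a2, a3, a4⟩ := this
    change (j' : ℝ) * S.μ 0 - j * S.μ 1 + S.ν 0 - S.ν 1 ≠ 0 ∧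
      (j' : ℝ) * S.μ 0 - j * S.μ 1 + S.ν 0 - S.ν 1 ≠ S.θ 1 ∧
      (j' : ℝ) * S.μ 0 - j * S.μ 1 + S.ν 0 - S.ν 1 ≠ -S.θ 0 ∧
      (j' : ℝ) * S.μ 0 - j * S.μ 1 + S.ν 0 - S.ν 1 ≠ S.θ 1 - S.θ 0
    refine ⟨fun e => a1 ?_, fun e => a3 ?_, fun e => a2 ?_, fun e => a4 ?_⟩ <;> linarith

end System

end GICSDA

end
-- The two cases of the proposition
theorem proposition5 (S : GICSDA.System)
    (hk : ∀ i, 0 < S.k i) (hN : ∀ i, 0 < S.N i) (hq : ∀ i, 0 < (S.q i : ℝ))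
    (hθ : ∀ i, 0 < S.θ i) (hν : ∀ i, 0 < S.ν i) (hγ : ∀ i, 0 < S.γ i)
    (hpre : Tendsto (fun n : ℕ => (S.pre n : ℝ) / (n : ℝ)) atTop (𝓝 0))
    (hμ : ∀ i, 1 < S.N i → S.θ i < S.μ i)
    (hends : ∀ j₁ j₂ : ℕ, 1 ≤ j₁ → j₁ ≤ S.N 0 → 1 ≤ j₂ → j₂ ≤ S.N 1 →
      (j₂ : ℝ) * S.μ 1 - (j₁ : ℝ) * S.μ 0 + S.ν 1 - S.ν 0 ∉
        ({0, S.θ 0, -S.θ 1, S.θ 0 - S.θ 1} : Set ℝ))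
    (i : Fin 2) (j : ℕ) (hj₁ : 1 ≤ j) (hj₂ : j ≤ S.N i)
    (hminus : S.omegaMinus i j ≠ 0) (hplus : S.omegaPlus i j ≠ 0) :
    (S.omegaMinus i j ≠ S.omegaPlus i j →
      S.η i - 1 / S.rate (GICSDA.other i) * (1 + (S.omega i j : ℝ)) * (S.φ i - S.ψ i)
            * S.η (GICSDA.other i)
          < S.θ i * S.ψ i
            - S.θ (GICSDA.other i) * (1 + (S.omega i j : ℝ)) * (S.φ i - S.ψ i) →
      S.ReliablyDecoded i j) ∧
    (S.omegaMinus i j = S.omegaPlus i j →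
      S.η i < S.θ i * S.ψ i →
      S.ReliablyDecoded i j) := by
  have h : S.Regular := ⟨hk, hN, hq, hθ, hν, hγ, hpre, hμ,
    GICSDA.System.offset_ne_of_zero hends⟩
  have hφψ := GICSDA.System.ψ_le_φ (S := S) i
  constructor
  · intro hne hlt
    refine h.reliablyDecoded hj₁ hj₂ ?_
    have hgap := mul_le_mul_of_nonneg_left (h.le_sum_gapLength hminus hplus hne)
      (sub_nonneg.2 hφψ)
    have hμ' : S.μ (GICSDA.other i)
        = 1 / S.rate (GICSDA.other i) * S.η (GICSDA.other i) := by
      rw [GICSDA.System.μ]; ring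
    -- With `μ' = η' / rate'`, the stated condition is the general rate condition for clear length
    -- `(1 + ω) (μ' - θ')`.
    have e : S.θ i * S.ψ i + (S.φ i - S.ψ i) *
        ((1 + (S.omega i j : ℝ)) * (S.μ (GICSDA.other i) - S.θ (GICSDA.other i))) =
        1 / S.rate (GICSDA.other i) * (1 + (S.omega i j : ℝ)) * (S.φ i - S.ψ i)
            * S.η (GICSDA.other i) + (S.θ i * S.ψ i
            - S.θ (GICSDA.other i) * (1 + (S.omega i j : ℝ)) * (S.φ i - S.ψ i)) := by
      rw [hμ']; ring
    linarith
  · intro _ hlt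
    refine h.reliablyDecoded hj₁ hj₂ ?_
    have : 0 ≤ ∑ j' ∈ Finset.range (S.N (GICSDA.other i) + 1), S.gapLength i j j' :=
      Finset.sum_nonneg fun j' _ => GICSDA.System.gapLength_nonneg i j j'
    have := mul_nonneg (sub_nonneg.2 hφψ) this
    linarith
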